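/- Let $q$ be an indeterminate, $\mathfrak{q}=q^2$, and let $U=U_q^{>}(L\mathfrak{sl}_2)$ be the associative $\mathbb{C}(q)$-algebra generated by $\{e_r\}_{r\in\mathbb{Z}}$ with the defining relations $(z-q^2w)\,e(z)e(w)=(q^2z-w)\,e(w)e(z)$, where $e(z)=\sum_{r\in\mathbb{Z}}e_rz^{-r}$. Put $[a,b]_x=ab-x\,ba$, $M_{1,n}=e_{-n}$, and for $k\ge 1$, $n\in\mathbb{Z}$ $$M_{k,n}=\frac{(-1)^{k(k-1)/2}}{(1-\mathfrak{q})^{k-1}}\,[\cdots[[M_{1,n-k+1},M_{1,n-k+3}]_{\mathfrak{q}^2},M_{1,n-k+5}]_{\mathfrak{q}^3},\cdots,M_{1,n+k-1}]_{\mathfrak{q}^k},\qquad \mathfrak{m}_k(z)=\sum_{n\in\mathbb{Z}}M_{k,n}z^n .$$ Let $\Delta_{\mathfrak{q}}(u_1,\ldots,u_k)=\prod_{1\le r<s\le k}\left(1-\mathfrak{q}\frac{u_s}{u_r}\right)$ and $\delta(x)=\sum_{n\in\mathbb{Z}}x^n$. Then for every $k\ge 1$ the product of formal series below is well defined (each of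 its coefficients is a finite sum), and $$\mathfrak{m}_k(z)=\mathrm{CT}_{u_1,\ldots,u_k}\left(\Delta_{\mathfrak{q}}(u_1,\ldots,u_k)\,\mathfrak{m}_1(u_1)\cdots\mathfrak{m}_1(u_k)\,\delta\!\left(\frac{u_1\cdots u_k}{z}\right)\right),$$ where $\mathrm{CT}_{u_1,\ldots,u_k}$ denotes the coefficient of $u_1^0\cdots u_k^0$, a formal series in $z$. -/

import Mathlib

namespace QSystem

noncomputable section

/-- The ground field `ℂ(q)`. -/
abbrev GroundField : Type := RatFunc ℂ

/-- The parameter `q ∈ ℂ(q)`. -/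
def qPar : GroundField := RatFunc.X

/-- The parameter `𝔮 = q²`. -/
def frakq : GroundField := qPar ^ 2

/-- The defining relations of the positive subalgebra `U_q^>(Lsl₂)`: the coefficients of
`z^(-a) w^(-b)`, for all integers `a`, `b`, in
`(z - q² w) e(z) e(w) = (q² z - w) e(w) e(z)`, where `e(z) = ∑ r : ℤ, e_r z^(-r)`.
(For `sl₂` there are no Serre relations.) -/
inductive EERel : FreeAlgebra GroundField ℤ → FreeAlgebra GroundField ℤ → Prop
  | quadratic (a b : ℤ) :
      EERel
        (FreeAlgebra.ι GroundField (a + 1) * FreeAlgebra.ι GroundField b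
          - (qPar ^ 2) • (FreeAlgebra.ι GroundField a * FreeAlgebra.ι GroundField (b + 1)))
        ((qPar ^ 2) • (FreeAlgebra.ι GroundField b * FreeAlgebra.ι GroundField (a + 1))
          - FreeAlgebra.ι GroundField (b + 1) * FreeAlgebra.ι GroundField a)

/-- The positive subalgebra `U_q^>(Lsl₂)`, as the `ℂ(q)`-algebra generated by `e_r`, `r ∈ ℤ`,
with the above defining relations. -/
abbrev UPos : Type := RingQuot EERel

/-- The loop generator `e_r` of `U_q^>(Lsl₂)`. -/
def e (r : ℤ) : UPos :=
  RingQuot.mkAlgHom GroundField EERel (FreeAlgebra.ι GroundField r)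

/-- The `x`-commutator `[a, b]_x = a b - x · b a`. -/
def qComm (x : GroundField) (a b : UPos) : UPos := a * b - x • (b * a)

/-- `M_{1,n} = e_{-n}`. -/
def M1 (n : ℤ) : UPos := e (-n)

/-- The left-nested commutator with `j + 1` entries
`[⋯[[M_{1,m}, M_{1,m+2}]_{𝔮^2}, M_{1,m+4}]_{𝔮^3}, ⋯, M_{1,m+2j}]_{𝔮^(j+1)}`. -/
def nestedComm (m : ℤ) : ℕ → UPos
  | 0 => M1 m
  | j + 1 => qComm (frakq ^ (j + 2)) (nestedComm m j) (M1 (m + 2 * ((j : ℤ) + 1)))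

/-- The elements `M_{k,n}` (used for `k ≥ 1`):
`(-1)^(k(k-1)/2) / (1 - 𝔮)^(k-1)` times the commutator
`[⋯[[M_{1,n-k+1}, M_{1,n-k+3}]_{𝔮^2}, M_{1,n-k+5}]_{𝔮^3}, ⋯, M_{1,n+k-1}]_{𝔮^k}`. -/
def M (k : ℕ) (n : ℤ) : UPos :=
  ((-1 : GroundField) ^ (k * (k - 1) / 2) / (1 - frakq) ^ (k - 1)) •
    nestedComm (n - k + 1) (k - 1)

/-- Formal series in `z^{±1}`, infinite in both directions, with coefficients in `U_q^>(Lsl₂)`: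
`f n` is the coefficient of `z^n`. -/
abbrev ZSeries : Type := ℤ → UPos

/-- The generating series `𝔪_k(z) = ∑ n : ℤ, M_{k,n} z^n`. -/
def mSeries (k : ℕ) : ZSeries := fun n => M k n

/-- Exponents `(a, b)` of monomials `u_1^(a_1) ⋯ u_k^(a_k) z^b`. -/
abbrev Expo (k : ℕ) : Type := (Fin k → ℤ) × ℤ

/-- Formal series in `u_1^{±1}, …, u_k^{±1}, z^{±1}`, infinite in all directions, with
coefficients in `U_q^>(Lsl₂)`: `F (a, b)` is the coefficient of `u^a z^b`. -/
abbrev UZSeries (k : ℕ) : Type := Expo k → UPos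

/-- The product of two formal series is defined when each of its coefficients is a sum with only
finitely many nonzero terms. -/
def MulDefined {k : ℕ} (F G : UZSeries k) : Prop :=
  ∀ c : Expo k, {a : Expo k | F a * G (c - a) ≠ 0}.Finite

/-- The product of two formal series (meaningful when `MulDefined F G` holds). -/
def seriesMul {k : ℕ} (F G : UZSeries k) : UZSeries k :=
  fun c => ∑ᶠ a : Expo k, F a * G (c - a)

/-- The ordered product `f_1(u_1) f_2(u_2) ⋯ f_k(u_k)` of series in distinct variables: the
coefficient of `u^a` is `f_{1,a_1} f_{2,a_2} ⋯ f_{k,a_k}`. -/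
def orderedProd {k : ℕ} (f : Fin k → ZSeries) : UZSeries k :=
  fun c => if c.2 = 0 then (List.ofFn fun r : Fin k => f r (c.1 r)).prod else 0

/-- The Laurent monomial `u_s / u_r`, with coefficient `x`. -/
def ratioMonomial {k : ℕ} (x : GroundField) (s r : Fin k) :
    AddMonoidAlgebra GroundField (Expo k) :=
  AddMonoidAlgebra.single (Pi.single s 1 - Pi.single r 1, 0) x

/-- The Laurent polynomial `Δ_𝔮(u_1, …, u_k) = ∏_{r < s} (1 - 𝔮 u_s / u_r)`. -/
def Delta (k : ℕ) : AddMonoidAlgebra GroundField (Expo k) :=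
  ∏ p ∈ Finset.univ.filter (fun p : Fin k × Fin k => p.1 < p.2),
    (1 - ratioMonomial frakq p.2 p.1)

/-- A Laurent polynomial with scalar coefficients, as a formal series. -/
def ofLaurent {k : ℕ} (p : AddMonoidAlgebra GroundField (Expo k)) : UZSeries k :=
  fun c => algebraMap GroundField UPos (p.coeff c)

/-- The delta-function `δ(x) = ∑ n : ℤ, x^n` evaluated at the monomial `x = u^(v.1) z^(v.2)`,
for `v ≠ 0`. -/
def deltaAt {k : ℕ} (v : Expo k) : UZSeries k :=
  fun c => ∑ᶠ n : ℤ, if c = n • v then (1 : UPos) else 0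

/-- The exponent of the monomial `u_1 ⋯ u_k / z`. -/
def prodOverZ (k : ℕ) : Expo k := (fun _ => 1, -1)

/-- The constant term `CT_{u_1, …, u_k}`, i.e. the coefficient of `u_1^0 ⋯ u_k^0`, a series
in `z`. -/
def constTerm {k : ℕ} (F : UZSeries k) : ZSeries := fun n => F (0, n)

end

end QSystem

/-! Put `x_i = u_i⁻¹`. Multiplying `Δ_𝔮` by `∏ x_s^(k-1)` gives the polynomial `stairVand`, and
extracting the coefficient of `(u_1 ⋯ u_k)^n` becomes applying to it a linear functional `evalM`,
which sends a monomial to an ordered product of shifted generators. The delta-function only selects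
this coefficient, so the theorem says `M k n = ctM k n`. Both sides agree for `k = 1`, and it
remains to show that `ctM` satisfies the recursion of the nested commutator (`ctM_succ`), that is,
that `evalM` kills one explicit polynomial, `recPoly`.

The quadratic relations say exactly that `evalM` kills `(x_{i+1} - q x_i) h` for `h` symmetric in
`x_i, x_{i+1}`. Hence every Demazure–Lusztig operator `T_i` acts as `q` under such a functional `Φ`,
and the Hecke symmetrizer `S` satisfies `Φ(S f) = [k+1]_q! Φ(f)` in `k + 1` variables. As `q` is not
a root of unity, `S f = 0` suffices. Since `S` kills the `-1` eigenvectors of the `T_i`, the map `g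
↦ S(qVand · g)` is antisymmetric; this reduces `S f = 0` to the vanishing of the antisymmetrization
of `f / qVand` (`map_eq_zero_of_antisymm_eq_zero`).

For `f = recPoly` that antisymmetrization is a combination of determinants with columns `x^{k-1}, …,
x^0` and one extra column. Lagrange interpolation (`exists_interpolation`) shows that the combined
extra column consists of the values of a polynomial of degree less than `k`, so the total vanishes.
-/

namespace QSystem

/-! ### Symmetrizers in Hecke algebras -/

section Hecke

variable {𝕜 R : Type*} [CommRing 𝕜] [Ring R] [Algebra 𝕜 R]

/-- The sum `1 + T_{j-1} + T_{j-1} T_{j-2} + ⋯ + T_{j-1} ⋯ T_0` over minimal coset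
representatives. -/
def cosetSum (T : ℕ → R) : ℕ → R
  | 0 => 1
  | j + 1 => 1 + T j * cosetSum T j

/-- The symmetrizer of the Hecke algebra generated by `T_0, …, T_{j-1}`. -/
def heckeSym (T : ℕ → R) : ℕ → R
  | 0 => 1
  | j + 1 => heckeSym T j * cosetSum T (j + 1)

/-- The relations of the Hecke algebra of type `A_m` with generators `T_0, …, T_{m-1}`. -/
structure IsHecke (q : 𝕜) (T : ℕ → R) (m : ℕ) : Prop where
  quad : ∀ i < m, T i * T i = (q - 1) • T i + q • (1 : R)
  braid : ∀ i, i + 1 < m → T i * T (i + 1) * T i = T (i + 1) * T i * T (i + 1)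
  comm : ∀ i j, i + 1 < j → j < m → T i * T j = T j * T i

variable {q : 𝕜} {T : ℕ → R} {m : ℕ}

lemma IsHecke.cosetSum_comm (h : IsHecke q T m) {j i : ℕ} (hj : j < i) (hi : i < m) :
    cosetSum T j * T i = T i * cosetSum T j := by
  induction j with
  | zero => simp [cosetSum]
  | succ j ih =>
    have h1 := h.comm j i hj hi
    have h2 := ih (by omega)
    simp only [cosetSum, add_mul, mul_add, one_mul, mul_one]
    rw [mul_assoc, h2, ← mul_assoc, h1, mul_assoc]

/-- The inductive step for the symmetrizer. For `i` below the top index, `x * T (j + 1)` inherits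
the hypothesis by commutation and induction applies. For the top index, the braid relation moves a
`T j` to the left, where `x` absorbs it, and the remaining part `1 + T (j + 1)` is handled by the
quadratic relation. -/
lemma IsHecke.mul_cosetSum (h : IsHecke q T m) {j : ℕ} (hj : j < m) (x : R)
    (hx : ∀ l < j, x * T l = q • x) {i : ℕ} (hi : i ≤ j) :
    x * cosetSum T (j + 1) * T i = q • (x * cosetSum T (j + 1)) := by
  induction j generalizing x i with
  | zero =>
    obtain rfl : i = 0 := by omega
    have := h.quad 0 hj
    simp only [cosetSum, mul_one, mul_add, add_mul, mul_assoc, this, smul_add, mul_smul_comm,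
      sub_smul, one_smul, mul_sub]
    abel
  | succ j ih =>
    rcases Nat.lt_or_ge i (j + 1) with hlt | hge
    · have h1 : ∀ l < j, x * T (j + 1) * T l = q • (x * T (j + 1)) := by
        intro l hl
        rw [mul_assoc, ← h.comm l (j + 1) (by omega) hj, ← mul_assoc, hx l (by omega),
          smul_mul_assoc]
      have h2 := ih (by omega) (x * T (j + 1)) h1 (i := i) (by omega)
      rw [cosetSum, mul_add, mul_one, ← mul_assoc, add_mul, h2, hx i hlt, smul_add]
    · obtain rfl : i = j + 1 := by omega
      have hq := h.quad (j + 1) hj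
      have hb := h.braid j hj
      have hc := h.cosetSum_comm (j := j) (i := j + 1) (by omega) hj
      have hxj := hx j (by omega)
      have key : x * (T (j + 1) * (T j * cosetSum T j)) * T (j + 1)
          = q • (x * (T (j + 1) * (T j * cosetSum T j))) := by
        calc x * (T (j + 1) * (T j * cosetSum T j)) * T (j + 1)
            = x * (T (j + 1) * T j * (cosetSum T j * T (j + 1))) := by simp only [mul_assoc]
          _ = x * (T (j + 1) * T j * T (j + 1) * cosetSum T j) := by rw [hc]; simp only [mul_assoc]
          _ = (x * T j) * (T (j + 1) * T j * cosetSum T j) := by rw [← hb]; simp only [mul_assoc]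
          _ = _ := by rw [hxj, smul_mul_assoc]; simp only [mul_assoc]
      have e1 : cosetSum T (j + 1 + 1) = 1 + T (j + 1) + T (j + 1) * (T j * cosetSum T j) := by
        simp only [cosetSum, mul_add, mul_one, add_assoc]
      rw [e1, mul_add, add_mul, key, smul_add]
      congr 1
      simp only [mul_one, mul_add, add_mul, mul_assoc, hq, smul_add, mul_smul_comm,
        sub_smul, one_smul, mul_sub]
      abel

lemma IsHecke.heckeSym_mul (h : IsHecke q T m) {j : ℕ} (hj : j ≤ m) {i : ℕ} (hi : i < j) :
    heckeSym T j * T i = q • heckeSym T j := by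
  induction j generalizing i with
  | zero => omega
  | succ j ih =>
    exact h.mul_cosetSum (by omega) _ (fun l hl => ih (by omega) hl) (by omega)

end Hecke

/-! ### Demazure–Lusztig operators -/

section DemazureLusztig

open MvPolynomial

variable {𝕜 : Type*} [Field 𝕜] {ι : Type*} [DecidableEq ι]

lemma X_sub_X_dvd_sub_rename_swap (a b : ι) (f : MvPolynomial ι 𝕜) :
    (X a - X b : MvPolynomial ι 𝕜) ∣ f - rename (Equiv.swap a b) f := by
  induction f using MvPolynomial.induction_on with
  | C c => simp
  | add f g hf hg =>
    rw [map_add]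
    convert dvd_add hf hg using 1
    ring
  | mul_X f i hf =>
    have h1 : (X a - X b : MvPolynomial ι 𝕜) ∣ X i - X (Equiv.swap a b i) := by
      rcases eq_or_ne i a with rfl | ha
      · simp
      rcases eq_or_ne i b with rfl | hb
      · rw [Equiv.swap_apply_right, dvd_sub_comm]
      · simp [Equiv.swap_apply_of_ne_of_ne ha hb]
    rw [map_mul, rename_X]
    convert dvd_add (hf.mul_right (X i)) (h1.mul_left (rename (Equiv.swap a b) f)) using 1
    ring

/-- The divided difference `(f - s_{ab} f) / (x_a - x_b)`. -/
noncomputable def divDiff (a b : ι) (f : MvPolynomial ι 𝕜) : MvPolynomial ι 𝕜 :=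
  (X_sub_X_dvd_sub_rename_swap a b f).choose

lemma mul_divDiff (a b : ι) (f : MvPolynomial ι 𝕜) :
    (X a - X b) * divDiff a b f = f - rename (Equiv.swap a b) f :=
  (X_sub_X_dvd_sub_rename_swap a b f).choose_spec.symm

omit [DecidableEq ι] in
lemma X_sub_X_ne_zero {a b : ι} (h : a ≠ b) : (X a - X b : MvPolynomial ι 𝕜) ≠ 0 :=
  sub_ne_zero.2 fun e => h (X_injective e)

lemma divDiff_eq {a b : ι} (h : a ≠ b) {f g : MvPolynomial ι 𝕜}
    (hg : (X a - X b) * g = f - rename (Equiv.swap a b) f) : divDiff a b f = g :=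
  mul_left_cancel₀ (X_sub_X_ne_zero h) (by rw [mul_divDiff, hg])

lemma rename_swap_divDiff {a b : ι} (h : a ≠ b) (f : MvPolynomial ι 𝕜) :
    rename (Equiv.swap a b) (divDiff a b f) = divDiff a b f := by
  refine mul_left_cancel₀ (X_sub_X_ne_zero h) ?_
  have h1 := congrArg (rename (Equiv.swap a b)) (mul_divDiff a b f)
  rw [map_mul, map_sub, map_sub, rename_X, rename_X, Equiv.swap_apply_left,
    Equiv.swap_apply_right, rename_rename, ← Equiv.coe_trans] at h1
  simp only [Equiv.swap_swap, Equiv.coe_refl, rename_id, AlgHom.id_apply] at h1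
  linear_combination -h1 - mul_divDiff a b f

/-- The Demazure–Lusztig operator `T_{ab} f = q f + (x_b - q x_a) (f - s_{ab} f) / (x_a - x_b)`. -/
noncomputable def demLus (q : 𝕜) {a b : ι} (h : a ≠ b) : Module.End 𝕜 (MvPolynomial ι 𝕜) where
  toFun f := C q * f + (X b - C q * X a) * divDiff a b f
  map_add' f g := by
    have : divDiff a b (f + g) = divDiff a b f + divDiff a b g :=
      divDiff_eq h (by rw [mul_add, mul_divDiff, mul_divDiff, map_add]; ring)
    rw [this]; ring
  map_smul' c f := by
    have : divDiff a b (c • f) = c • divDiff a b f :=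
      divDiff_eq h (by rw [mul_smul_comm, mul_divDiff, map_smul, smul_sub])
    rw [this, RingHom.id_apply, smul_add, mul_smul_comm, mul_smul_comm]

lemma demLus_apply (q : 𝕜) {a b : ι} (h : a ≠ b) (f : MvPolynomial ι 𝕜) :
    demLus q h f = C q * f + (X b - C q * X a) * divDiff a b f := rfl

lemma demLus_mul (q : 𝕜) {a b : ι} (h : a ≠ b) {d : MvPolynomial ι 𝕜}
    (hd : rename (Equiv.swap a b) d = d) (f : MvPolynomial ι 𝕜) :
    demLus q h (d * f) = d * demLus q h f := by
  have : divDiff a b (d * f) = d * divDiff a b f :=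
    divDiff_eq h (by rw [mul_left_comm, mul_divDiff, map_mul, hd]; ring)
  rw [demLus_apply, demLus_apply, this]; ring

/-- These are `-1` eigenvectors because the divided difference of `x_b - q x_a` is `-(1 + q)`. Since
`T - q` takes values among them, the quadratic relation follows. -/
lemma demLus_neg (q : 𝕜) {a b : ι} (h : a ≠ b) {g : MvPolynomial ι 𝕜}
    (hg : rename (Equiv.swap a b) g = g) :
    demLus q h ((X b - C q * X a) * g) = -((X b - C q * X a) * g) := by
  have : divDiff a b ((X b - C q * X a) * g) = -(1 + C q) * g :=
    divDiff_eq h (by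
      rw [map_mul, hg, map_sub, map_mul, rename_X, rename_X, rename_C, Equiv.swap_apply_left,
        Equiv.swap_apply_right]
      ring)
  rw [demLus_apply, this]; ring

lemma demLus_quad (q : 𝕜) {a b : ι} (h : a ≠ b) :
    demLus q h * demLus q h = (q - 1) • demLus q h + q • (1 : Module.End 𝕜 (MvPolynomial ι 𝕜)) := by
  refine LinearMap.ext fun f => ?_
  have h1 := demLus_neg q h (rename_swap_divDiff h f)
  have h2 : (X b - C q * X a) * divDiff a b f = demLus q h f - q • f := by
    rw [demLus_apply, smul_eq_C_mul]; ring
  rw [h2, map_sub, map_smul] at h1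
  simp only [Module.End.mul_apply, LinearMap.add_apply, LinearMap.smul_apply, Module.End.one_apply,
    sub_smul, one_smul]
  linear_combination h1

/-- The fraction field in which operators are compared. -/
abbrev FracPoly (𝕜 ι : Type*) [Field 𝕜] : Type _ := FractionRing (MvPolynomial ι 𝕜)

/-- The generic point `(x_i)` of the fraction field. -/
noncomputable def genPt (𝕜 : Type*) [Field 𝕜] {ι : Type*} (i : ι) : FracPoly 𝕜 ι :=
  algebraMap (MvPolynomial ι 𝕜) _ (X i)

omit [DecidableEq ι] in
lemma genPt_injective : Function.Injective (genPt 𝕜 : ι → FracPoly 𝕜 ι) :=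
  (FaithfulSMul.algebraMap_injective _ _).comp X_injective

/-- The value of a permuted polynomial in the fraction field. -/
noncomputable def permVal (f : MvPolynomial ι 𝕜) (σ : Equiv.Perm ι) : FracPoly 𝕜 ι :=
  algebraMap (MvPolynomial ι 𝕜) _ (rename σ f)

/-- Over the fraction field the operator is a combination of permutations with rational
coefficients, so operator relations become rational identities in the permuted values of `f`. -/
lemma permVal_demLus (q : 𝕜) {a b : ι} (h : a ≠ b) (f : MvPolynomial ι 𝕜) (σ : Equiv.Perm ι) :
    permVal (demLus q h f) σ = algebraMap 𝕜 _ q * permVal f σ +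
      (genPt 𝕜 (σ b) - algebraMap 𝕜 _ q * genPt 𝕜 (σ a)) *
        ((permVal f σ - permVal f (σ * Equiv.swap a b)) / (genPt 𝕜 (σ a) - genPt 𝕜 (σ b))) := by
  have hne : (genPt 𝕜 (σ a) - genPt 𝕜 (σ b) : FracPoly 𝕜 ι) ≠ 0 :=
    sub_ne_zero.2 fun e => h (σ.injective (genPt_injective e))
  have h1 : (genPt 𝕜 (σ a) - genPt 𝕜 (σ b)) * permVal (divDiff a b f) σ
      = permVal f σ - permVal f (σ * Equiv.swap a b) := by
    have := congrArg (fun g => algebraMap (MvPolynomial ι 𝕜) (FracPoly 𝕜 ι) (rename σ g))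
      (mul_divDiff a b f)
    simp only [map_mul, map_sub, rename_X, rename_rename, ← Equiv.Perm.coe_mul] at this
    exact this
  have h2 : permVal (divDiff a b f) σ = (permVal f σ - permVal f (σ * Equiv.swap a b)) /
      (genPt 𝕜 (σ a) - genPt 𝕜 (σ b)) := by
    rw [eq_div_iff hne, ← h1, mul_comm]
  rw [← h2, demLus_apply]
  simp only [permVal, map_add, map_mul, map_sub, rename_X, rename_C, genPt]
  rw [← MvPolynomial.algebraMap_eq, ← IsScalarTower.algebraMap_apply]

omit [DecidableEq ι] in
lemma eq_of_permVal {f g : MvPolynomial ι 𝕜} (h : permVal f 1 = permVal g 1) : f = g := by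
  have := FaithfulSMul.algebraMap_injective (MvPolynomial ι 𝕜) (FracPoly 𝕜 ι) h
  simpa using this

lemma demLus_comm (q : 𝕜) {a b c d : ι} (hab : a ≠ b) (hcd : c ≠ d) (hac : a ≠ c) (had : a ≠ d)
    (hbc : b ≠ c) (hbd : b ≠ d) :
    demLus q hab * demLus q hcd = demLus q hcd * demLus q hab := by
  have e : Equiv.swap a b * Equiv.swap c d = Equiv.swap c d * Equiv.swap a b :=
    (Equiv.Perm.disjoint_swap_swap (by simp [*])).commute
  refine LinearMap.ext fun f => ?_
  apply eq_of_permVal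
  simp only [Module.End.mul_apply, permVal_demLus, one_mul, Equiv.Perm.one_apply, e,
    Equiv.swap_apply_of_ne_of_ne hac had, Equiv.swap_apply_of_ne_of_ne hbc hbd,
    Equiv.swap_apply_of_ne_of_ne hac.symm hbc.symm, Equiv.swap_apply_of_ne_of_ne had.symm hbd.symm]
  ring

lemma demLus_braid (q : 𝕜) {a b c : ι} (hab : a ≠ b) (hbc : b ≠ c) (hac : a ≠ c) :
    demLus q hab * demLus q hbc * demLus q hab = demLus q hbc * demLus q hab * demLus q hbc := by
  have e : Equiv.swap b c * Equiv.swap a b * Equiv.swap b c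
      = Equiv.swap a b * Equiv.swap b c * Equiv.swap a b := by
    rw [Equiv.swap_mul_swap_mul_swap hab hac, Equiv.swap_comm a b, Equiv.swap_comm b c,
      Equiv.swap_mul_swap_mul_swap hbc.symm hac.symm, Equiv.swap_comm]
  refine LinearMap.ext fun f => ?_
  apply eq_of_permVal
  have h1 : (genPt 𝕜 a - genPt 𝕜 b : FracPoly 𝕜 ι) ≠ 0 :=
    sub_ne_zero.2 fun e => hab (genPt_injective e)
  have h2 : (genPt 𝕜 b - genPt 𝕜 c : FracPoly 𝕜 ι) ≠ 0 :=
    sub_ne_zero.2 fun e => hbc (genPt_injective e)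
  have h3 : (genPt 𝕜 a - genPt 𝕜 c : FracPoly 𝕜 ι) ≠ 0 :=
    sub_ne_zero.2 fun e => hac (genPt_injective e)
  have h1' : (genPt 𝕜 b - genPt 𝕜 a : FracPoly 𝕜 ι) ≠ 0 := by rwa [← neg_sub, neg_ne_zero]
  have h2' : (genPt 𝕜 c - genPt 𝕜 b : FracPoly 𝕜 ι) ≠ 0 := by rwa [← neg_sub, neg_ne_zero]
  have h3' : (genPt 𝕜 c - genPt 𝕜 a : FracPoly 𝕜 ι) ≠ 0 := by rwa [← neg_sub, neg_ne_zero]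
  simp only [Module.End.mul_apply, permVal_demLus, one_mul, Equiv.Perm.one_apply, e,
    Equiv.Perm.mul_apply, Equiv.swap_apply_left, Equiv.swap_apply_right, Equiv.swap_mul_self,
    Equiv.swap_apply_of_ne_of_ne hac.symm hbc.symm, Equiv.swap_apply_of_ne_of_ne hab hac]
  -- The values of `f` at the six permutations of three variables may be treated as independent
  -- unknowns.
  generalize permVal f 1 = f1
  generalize permVal f (Equiv.swap a b) = f2
  generalize permVal f (Equiv.swap b c) = f3
  generalize permVal f (Equiv.swap a b * Equiv.swap b c) = f4
  generalize permVal f (Equiv.swap b c * Equiv.swap a b) = f5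
  generalize permVal f (Equiv.swap a b * Equiv.swap b c * Equiv.swap a b) = f6
  generalize (genPt 𝕜 a : FracPoly 𝕜 ι) = x at *
  generalize (genPt 𝕜 b : FracPoly 𝕜 ι) = y at *
  generalize (genPt 𝕜 c : FracPoly 𝕜 ι) = z at *
  generalize (algebraMap 𝕜 (FracPoly 𝕜 ι) q) = t at *
  rw [show y - x = -(x - y) by ring, show z - y = -(y - z) by ring]
  field_simp
  ring

end DemazureLusztig

/-! ### Vanishing criterion for functionals killed by the Hecke relations -/

section Vanishing

open MvPolynomial

variable {𝕜 : Type*} [Field 𝕜] {m : ℕ}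

/-- The Demazure–Lusztig operators in `m + 1` variables. -/
noncomputable def demLusFin (q : 𝕜) (m i : ℕ) : Module.End 𝕜 (MvPolynomial (Fin (m + 1)) 𝕜) :=
  if h : i < m then
    demLus q (a := (⟨i, h⟩ : Fin m).castSucc) (b := (⟨i, h⟩ : Fin m).succ) Fin.castSucc_lt_succ.ne
  else 0

lemma demLusFin_val (q : 𝕜) (i : Fin m) :
    demLusFin q m i = demLus q (a := i.castSucc) (b := i.succ) Fin.castSucc_lt_succ.ne := by
  simp [demLusFin]

lemma isHecke_demLusFin (q : 𝕜) : IsHecke q (demLusFin q m) m where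
  quad i hi := by
    lift i to Fin m using hi
    rw [demLusFin_val]
    exact demLus_quad q _
  braid i hi := by
    have h0 : i < m := by omega
    simp only [demLusFin, h0, hi, dif_pos]
    refine demLus_braid q (a := (⟨i, h0⟩ : Fin m).castSucc) (b := (⟨i, h0⟩ : Fin m).succ)
      (c := (⟨i + 1, hi⟩ : Fin m).succ) _ _ ?_
    simp only [ne_eq, Fin.ext_iff, Fin.val_castSucc, Fin.val_succ]
    omega
  comm i j hij hj := by
    have h0 : i < m := by omega
    simp only [demLusFin, h0, hj, dif_pos]
    apply demLus_comm <;> simp only [ne_eq, Fin.ext_iff, Fin.val_castSucc, Fin.val_succ] <;> omega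

/-- The coset sum contains one product of each length `l ≤ j`, and each factor contributes `q`. -/
lemma map_cosetSum {V : Type*} [AddCommGroup V] [Module 𝕜 V] (q : 𝕜)
    (Φ : MvPolynomial (Fin (m + 1)) 𝕜 →ₗ[𝕜] V)
    (hΦ : ∀ (i : Fin m) f, Φ (demLusFin q m i f) = q • Φ f) {j : ℕ} (hj : j ≤ m)
    (f : MvPolynomial (Fin (m + 1)) 𝕜) :
    Φ (cosetSum (demLusFin q m) j f) = (∑ l ∈ Finset.range (j + 1), q ^ l) • Φ f := by
  induction j with
  | zero => simp [cosetSum]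
  | succ j ih =>
    have := hΦ ⟨j, hj⟩ (cosetSum (demLusFin q m) j f)
    rw [cosetSum, LinearMap.add_apply, Module.End.one_apply, Module.End.mul_apply, map_add, this,
      ih (by omega), Finset.sum_range_succ' _ (j + 1), smul_smul, Finset.mul_sum, add_smul,
      pow_zero, one_smul, add_comm]
    simp only [pow_succ']

lemma map_heckeSym {V : Type*} [AddCommGroup V] [Module 𝕜 V] (q : 𝕜)
    (Φ : MvPolynomial (Fin (m + 1)) 𝕜 →ₗ[𝕜] V)
    (hΦ : ∀ (i : Fin m) f, Φ (demLusFin q m i f) = q • Φ f) {j : ℕ} (hj : j ≤ m)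
    (f : MvPolynomial (Fin (m + 1)) 𝕜) :
    Φ (heckeSym (demLusFin q m) j f) =
      (∏ i ∈ Finset.range j, ∑ l ∈ Finset.range (i + 2), q ^ l) • Φ f := by
  induction j generalizing f with
  | zero => simp [heckeSym]
  | succ j ih =>
    rw [heckeSym, Module.End.mul_apply, ih (by omega), map_cosetSum q Φ hΦ hj,
      Finset.prod_range_succ, smul_smul]

lemma cosetSum_demLusFin_mul (q : 𝕜) {d : MvPolynomial (Fin (m + 1)) 𝕜}
    (hd : ∀ σ : Equiv.Perm (Fin (m + 1)), rename σ d = d) {j : ℕ} (hj : j ≤ m)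
    (f : MvPolynomial (Fin (m + 1)) 𝕜) :
    cosetSum (demLusFin q m) j (d * f) = d * cosetSum (demLusFin q m) j f := by
  induction j with
  | zero => simp [cosetSum]
  | succ j ih =>
    have h1 := demLusFin_val q (⟨j, hj⟩ : Fin m)
    simp only at h1
    simp only [cosetSum, LinearMap.add_apply, Module.End.one_apply, Module.End.mul_apply]
    rw [ih (by omega), h1, demLus_mul q _ (hd _), mul_add]

lemma heckeSym_demLusFin_mul (q : 𝕜) {d : MvPolynomial (Fin (m + 1)) 𝕜}
    (hd : ∀ σ : Equiv.Perm (Fin (m + 1)), rename σ d = d) {j : ℕ} (hj : j ≤ m)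
    (f : MvPolynomial (Fin (m + 1)) 𝕜) :
    heckeSym (demLusFin q m) j (d * f) = d * heckeSym (demLusFin q m) j f := by
  induction j generalizing f with
  | zero => simp [heckeSym]
  | succ j ih =>
    rw [heckeSym, Module.End.mul_apply, cosetSum_demLusFin_mul q hd hj, ih (by omega),
      Module.End.mul_apply]

/-- The product `∏_{r < s} (x_s - q x_r)`. -/
noncomputable def qVand {A : Type*} [CommRing A] (q : A) {n : ℕ} (x : Fin n → A) : A :=
  ∏ p ∈ Finset.univ.filter (fun p : Fin n × Fin n => p.1 < p.2), (x p.2 - q * x p.1)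

/-- The product `∏_{r < s} (x_r - q x_s)`. -/
noncomputable def qVandRev {A : Type*} [CommRing A] (q : A) {n : ℕ} (x : Fin n → A) : A :=
  ∏ p ∈ Finset.univ.filter (fun p : Fin n × Fin n => p.1 < p.2), (x p.1 - q * x p.2)

lemma map_qVand {A B : Type*} [CommRing A] [CommRing B] (φ : A →+* B) (q : A) {n : ℕ}
    (x : Fin n → A) : φ (qVand q x) = qVand (φ q) (fun i => φ (x i)) := by
  simp [qVand, map_prod]

lemma map_qVandRev {A B : Type*} [CommRing A] [CommRing B] (φ : A →+* B) (q : A) {n : ℕ}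
    (x : Fin n → A) : φ (qVandRev q x) = qVandRev (φ q) (fun i => φ (x i)) := by
  simp [qVandRev, map_prod]

/-- The symmetric product `∏_{r ≠ s} (x_s - q x_r)`. -/
noncomputable def qDisc {A : Type*} [CommRing A] (q : A) {n : ℕ} (x : Fin n → A) : A :=
  ∏ p ∈ Finset.univ.filter (fun p : Fin n × Fin n => p.1 ≠ p.2), (x p.2 - q * x p.1)

lemma qVand_mul_qVandRev {A : Type*} [CommRing A] (q : A) {n : ℕ} (x : Fin n → A) :
    qVand q x * qVandRev q x = qDisc q x := by
  have h1 : qVandRev q x = ∏ p ∈ Finset.univ.filter (fun p : Fin n × Fin n => p.2 < p.1),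
      (x p.2 - q * x p.1) := by
    refine Finset.prod_equiv (Equiv.prodComm _ _) ?_ ?_ <;> simp
  rw [h1, qVand, qDisc, ← Finset.prod_union]
  · congr 1
    ext p
    simp [lt_or_lt_iff_ne]
  · rw [Finset.disjoint_filter]
    intro p _ h h'
    exact lt_asymm h h'

lemma qDisc_comp_perm {A : Type*} [CommRing A] (q : A) {n : ℕ} (x : Fin n → A)
    (σ : Equiv.Perm (Fin n)) : qDisc q (fun i => x (σ i)) = qDisc q x := by
  refine Finset.prod_equiv (Equiv.prodCongr σ σ) ?_ ?_ <;> simp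

lemma map_qDisc {A B : Type*} [CommRing A] [CommRing B] (φ : A →+* B) (q : A) {n : ℕ}
    (x : Fin n → A) : φ (qDisc q x) = qDisc (φ q) (fun i => φ (x i)) := by
  simp [qDisc, map_prod]

lemma rename_qDisc (q : 𝕜) {n : ℕ} (σ : Equiv.Perm (Fin n)) :
    rename σ (qDisc (C q) X : MvPolynomial (Fin n) 𝕜) = qDisc (C q) X := by
  have := map_qDisc (rename σ : MvPolynomial (Fin n) 𝕜 →ₐ[𝕜] MvPolynomial (Fin n) 𝕜).toRingHom (C q) X
  simp only [AlgHom.toRingHom_eq_coe, RingHom.coe_coe, rename_C, rename_X] at this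
  rw [this]
  exact qDisc_comp_perm _ _ σ

/-- An adjacent transposition preserves the order of every pair except the one it exchanges, so it
permutes the remaining factors. -/
lemma exists_qVand_eq (q : 𝕜) (i : Fin m) :
    ∃ w : MvPolynomial (Fin (m + 1)) 𝕜, rename (Equiv.swap i.castSucc i.succ) w = w ∧
      qVand (C q) X = (X i.succ - C q * X i.castSucc) * w := by
  refine ⟨∏ p ∈ (Finset.univ.filter
    (fun p : Fin (m + 1) × Fin (m + 1) => p.1 < p.2)).erase (i.castSucc, i.succ),
      (X p.2 - C q * X p.1), ?_, ?_⟩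
  · rw [map_prod]
    refine Finset.prod_equiv (Equiv.prodCongr (Equiv.swap i.castSucc i.succ)
      (Equiv.swap i.castSucc i.succ)) ?_ ?_
    · rintro ⟨r, s⟩
      simp only [Finset.mem_erase, Finset.mem_filter, Finset.mem_univ, true_and,
        Equiv.prodCongr_apply, Prod.map, ne_eq, Prod.mk.injEq, Equiv.swap_apply_def, Fin.ext_iff,
        Fin.lt_def, Fin.val_castSucc, Fin.val_succ]
      split_ifs <;> simp only [Fin.val_castSucc, Fin.val_succ] <;>
        (try simp only [true_and, and_true, not_true_eq_false, false_and, iff_false]) <;> omega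
    · simp
  · have h : (i.castSucc, i.succ) ∈ Finset.univ.filter
        (fun p : Fin (m + 1) × Fin (m + 1) => p.1 < p.2) := by simp
    rw [qVand, ← Finset.mul_prod_erase _ _ h]

/-- With `s` the transposition, `qVand * (g + s g)` is a `-1` eigenvector of `T_i`, while the
symmetrizer absorbs `T_i` as `q`. Its image is therefore killed by `1 + q`. -/
lemma heckeSym_qVand_mul_rename {q : 𝕜} (hq : 1 + q ≠ 0) (i : Fin m)
    (g : MvPolynomial (Fin (m + 1)) 𝕜) :
    heckeSym (demLusFin q m) m
        (qVand (C q) X * rename (Equiv.swap i.castSucc i.succ) g) =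
      -heckeSym (demLusFin q m) m (qVand (C q) X * g) := by
  obtain ⟨w, hw, hW⟩ := exists_qVand_eq q i
  set s := Equiv.swap i.castSucc i.succ
  have hs : rename s (w * (g + rename s g)) = w * (g + rename s g) := by
    rw [map_mul, hw, map_add, rename_rename, ← Equiv.coe_trans, Equiv.swap_swap]
    simp [add_comm]
  have h1 := demLus_neg q (a := i.castSucc) (b := i.succ) Fin.castSucc_lt_succ.ne hs
  have h2 := (isHecke_demLusFin (m := m) q).heckeSym_mul le_rfl i.2
  have h3 := LinearMap.congr_fun h2 ((X i.succ - C q * X i.castSucc) * (w * (g + rename s g)))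
  rw [Module.End.mul_apply, demLusFin_val, h1, ← mul_assoc, ← hW, map_neg,
    LinearMap.smul_apply] at h3
  have h4 : (1 + q) • heckeSym (demLusFin q m) m (qVand (C q) X * (g + rename s g)) = 0 := by
    rw [add_smul, one_smul, ← h3, add_neg_cancel]
  have h5 := (smul_eq_zero.1 h4).resolve_left hq
  rw [mul_add, map_add] at h5
  exact eq_neg_of_add_eq_zero_right h5

lemma heckeSym_qVand_mul_rename_perm {q : 𝕜} (hq : 1 + q ≠ 0)
    (σ : Equiv.Perm (Fin (m + 1))) (g : MvPolynomial (Fin (m + 1)) 𝕜) :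
    heckeSym (demLusFin q m) m (qVand (C q) X * rename σ g) =
      ((Equiv.Perm.sign σ : ℤ) : 𝕜) • heckeSym (demLusFin q m) m (qVand (C q) X * g) := by
  induction σ using Submonoid.induction_of_closure_eq_top_left
    (Equiv.Perm.mclosure_swap_castSucc_succ m) with
  | one => simp
  | mul_left x hx τ ih =>
    obtain ⟨i, rfl⟩ := hx
    rw [Equiv.Perm.coe_mul, ← rename_rename, heckeSym_qVand_mul_rename hq, ih,
      Equiv.Perm.sign_mul, Equiv.Perm.sign_swap Fin.castSucc_lt_succ.ne]
    simp

/-- A functional killed by all `(x_{i+1} - q x_i) h` with `h` symmetric in `x_i, x_{i+1}` kills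
every polynomial whose twisted antisymmetrization vanishes. -/
theorem map_eq_zero_of_antisymm_eq_zero [CharZero 𝕜] {q : 𝕜}
    (hq : ∀ i : ℕ, ∑ l ∈ Finset.range (i + 2), q ^ l ≠ 0)
    {V : Type*} [AddCommGroup V] [Module 𝕜 V]
    (Φ : MvPolynomial (Fin (m + 1)) 𝕜 →ₗ[𝕜] V)
    (hΦ : ∀ (i : Fin m) h, rename (Equiv.swap i.castSucc i.succ) h = h →
      Φ ((X i.succ - C q * X i.castSucc) * h) = 0)
    (hD : qDisc (C q) (X : Fin (m + 1) → MvPolynomial (Fin (m + 1)) 𝕜) ≠ 0)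
    {f : MvPolynomial (Fin (m + 1)) 𝕜}
    (hf : ∑ σ : Equiv.Perm (Fin (m + 1)),
      ((Equiv.Perm.sign σ : ℤ) : 𝕜) • rename σ (qVandRev (C q) X * f) = 0) : Φ f = 0 := by
  have hq1 : 1 + q ≠ 0 := by simpa [Finset.sum_range_succ] using hq 0
  have h1 : heckeSym (demLusFin q m) m (qDisc (C q) X * f) = 0 := by
    -- The sign produced by moving `σ` through the symmetrizer cancels the sign in the sum, so all
    -- `(m + 1)!` terms equal the symmetrizer of `qDisc * f`; the symmetric factor `qDisc` then
    -- comes out.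
    have h2 : heckeSym (demLusFin q m) m (qVand (C q) X * ∑ σ : Equiv.Perm (Fin (m + 1)),
      ((Equiv.Perm.sign σ : ℤ) : 𝕜) • rename σ (qVandRev (C q) X * f)) = 0 := by
      rw [hf, mul_zero, map_zero]
    simp only [Finset.mul_sum, map_sum, mul_smul_comm, map_smul,
      heckeSym_qVand_mul_rename_perm hq1, smul_smul] at h2
    have h3 : ∀ σ : Equiv.Perm (Fin (m + 1)),
        ((Equiv.Perm.sign σ : ℤ) : 𝕜) * ((Equiv.Perm.sign σ : ℤ) : 𝕜) = 1 := fun σ => by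
      rcases Int.units_eq_one_or (Equiv.Perm.sign σ) with h | h <;> simp [h]
    simp only [h3, one_smul, Finset.sum_const, ← mul_assoc, qVand_mul_qVandRev] at h2
    rw [← Nat.cast_smul_eq_nsmul 𝕜] at h2
    refine (smul_eq_zero.1 h2).resolve_left ?_
    simp [Fintype.card_perm, Nat.factorial_ne_zero]
  rw [heckeSym_demLusFin_mul q (rename_qDisc q) le_rfl] at h1
  have h2 := (mul_eq_zero.1 h1).resolve_left hD
  have hT : ∀ (i : Fin m) f, Φ (demLusFin q m i f) = q • Φ f := by
    intro i f
    rw [demLusFin_val, demLus_apply, map_add,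
      hΦ i _ (rename_swap_divDiff Fin.castSucc_lt_succ.ne f), add_zero,
      ← smul_eq_C_mul, map_smul]
  have h3 := map_heckeSym q Φ hT le_rfl f
  rw [h2, map_zero] at h3
  exact (smul_eq_zero.1 h3.symm).resolve_left (Finset.prod_ne_zero_iff.2 fun i _ => hq i)

end Vanishing

/-! ### The antisymmetrization identity -/

section Antisymmetrization

open Polynomial in
-- Write `X^(2k+1) = a χq + b χ` with `χ = ∏ (X - x_r)`, `χq = ∏ (X - q x_r)` and `a`, `b` of degree
-- at most `k`. The first two terms on the right are the values at `x i` of `a` and `q^(-k) b(qX)`,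
-- and subtracting `X^k` cancels the coefficient of degree `k`.
lemma exists_interpolation {F : Type*} [Field F] {k : ℕ} (hk : 0 < k) {q : F} (hq : q ≠ 0)
    {x : Fin (k + 1) → F} (hx : Function.Injective x) (hxq : ∀ i j, x i ≠ q * x j) :
    ∃ p : F[X], p.natDegree < k ∧ ∀ i, p.eval (x i) =
      x i ^ (2 * k + 1) / (∏ r, (x i - q * x r)) -
        (-1) ^ k * q ^ (k + 1) * (x i ^ (2 * k + 1) / ∏ r, (x r - q * x i)) - x i ^ k := by
  classical
  have hx' : Function.Injective fun i => q * x i := fun i j h => hx (mul_left_cancel₀ hq h)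
  set χ := Lagrange.nodal Finset.univ x with hχ
  set χq := Lagrange.nodal Finset.univ (fun i => q * x i) with hχq
  have hχqx : ∀ i, χq.eval (x i) ≠ 0 := fun i => by
    rw [hχq, Lagrange.eval_nodal]
    exact Finset.prod_ne_zero_iff.2 fun j _ => sub_ne_zero.2 (hxq i j)
  have hχx : ∀ i, χ.eval (q * x i) ≠ 0 := fun i => by
    rw [hχ, Lagrange.eval_nodal]
    exact Finset.prod_ne_zero_iff.2 fun j _ => sub_ne_zero.2 (hxq j i).symm
  set a := Lagrange.interpolate Finset.univ x (fun i => x i ^ (2 * k + 1) / χq.eval (x i)) with ha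
  set b := Lagrange.interpolate Finset.univ (fun i => q * x i)
    (fun i => (q * x i) ^ (2 * k + 1) / χ.eval (q * x i)) with hb
  have ha_eval : ∀ i, a.eval (x i) = x i ^ (2 * k + 1) / χq.eval (x i) := fun i =>
    Lagrange.eval_interpolate_at_node _ hx.injOn (Finset.mem_univ i)
  have hb_eval : ∀ i, b.eval (q * x i) = (q * x i) ^ (2 * k + 1) / χ.eval (q * x i) := fun i =>
    Lagrange.eval_interpolate_at_node (v := fun i => q * x i) _ hx'.injOn (Finset.mem_univ i)
  have ha_deg : a.natDegree ≤ k := by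
    refine Polynomial.natDegree_le_of_degree_le ?_
    refine (Lagrange.degree_interpolate_le _ hx.injOn).trans ?_
    simp
  have hb_deg : b.natDegree ≤ k := by
    refine Polynomial.natDegree_le_of_degree_le ?_
    refine (Lagrange.degree_interpolate_le _ hx'.injOn).trans ?_
    simp
  have hχ_deg : χ.natDegree = k + 1 := by simp [hχ, Lagrange.natDegree_nodal]
  have hχq_deg : χq.natDegree = k + 1 := by simp [hχq, Lagrange.natDegree_nodal]
  have hχ_coeff : χ.coeff (k + 1) = 1 := by
    rw [← hχ_deg]; exact Lagrange.nodal_monic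
  have hχq_coeff : χq.coeff (k + 1) = 1 := by
    rw [← hχq_deg]; exact Lagrange.nodal_monic
  -- Both sides have degree below `2k + 2` and agree at the `2k + 2` distinct nodes `x_i`, `q x_i`.
  have key : (X ^ (2 * k + 1) : F[X]) = a * χq + b * χ := by
    have hv : Set.InjOn (Sum.elim x fun i => q * x i)
        ((Finset.univ : Finset (Fin (k + 1) ⊕ Fin (k + 1))) : Set _) := by
      apply Function.Injective.injOn
      exact hx.sumElim hx' hxq
    have hcard : (Finset.univ : Finset (Fin (k + 1) ⊕ Fin (k + 1))).card = 2 * k + 2 := by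
      simp; ring
    refine Polynomial.eq_of_degrees_lt_of_eval_index_eq Finset.univ hv ?_ ?_ ?_
    · rw [hcard, degree_X_pow]
      exact_mod_cast Nat.lt_succ_self _
    · rw [hcard]
      have h : (a * χq + b * χ).natDegree ≤ 2 * k + 1 := by
        refine natDegree_add_le_of_degree_le (natDegree_mul_le.trans ?_)
          (natDegree_mul_le.trans ?_) <;> omega
      refine (degree_le_of_natDegree_le h).trans_lt ?_
      exact_mod_cast Nat.lt_succ_self _
    · rintro (i | i) -
      · have : χ.eval (x i) = 0 := Lagrange.eval_nodal_at_node (Finset.mem_univ i)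
        simp [ha_eval, this, div_mul_cancel₀ _ (hχqx i)]
      · have : χq.eval (q * x i) = 0 :=
          Lagrange.eval_nodal_at_node (v := fun i => q * x i) (Finset.mem_univ i)
        simp [hb_eval, this, div_mul_cancel₀ _ (hχx i)]
  have hlead : a.coeff k + b.coeff k = 1 := by
    have h := congrArg (fun p : F[X] => p.coeff (k + (k + 1))) key
    simp only [coeff_add] at h
    rw [coeff_mul_add_eq_of_natDegree_le ha_deg hχq_deg.le, coeff_mul_add_eq_of_natDegree_le hb_deg hχ_deg.le,
      hχ_coeff, hχq_coeff, show k + (k + 1) = 2 * k + 1 by ring, coeff_X_pow_self] at h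
    simpa using h.symm
  refine ⟨a + C (q ^ k)⁻¹ * b.comp (C q * X) - X ^ k, ?_, fun i => ?_⟩
  · have h1 : (a + C (q ^ k)⁻¹ * b.comp (C q * X) - X ^ k).natDegree ≤ k := by
      refine (natDegree_sub_le_of_le (natDegree_add_le_of_degree_le ha_deg
        ((natDegree_C_mul_le _ _).trans (natDegree_comp_le.trans ?_))) (natDegree_X_pow_le k)).trans_eq (max_self k)
      calc b.natDegree * (C q * X : F[X]).natDegree ≤ k * 1 :=
            Nat.mul_le_mul hb_deg ((natDegree_C_mul_le _ _).trans natDegree_X_le)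
        _ = k := mul_one k
    have h2 : (a + C (q ^ k)⁻¹ * b.comp (C q * X) - X ^ k).coeff k = 0 := by
      rw [coeff_sub, coeff_add, coeff_C_mul, comp_C_mul_X_coeff, coeff_X_pow_self, ← hlead]
      field_simp
      ring
    generalize a + C (q ^ k)⁻¹ * b.comp (C q * X) - X ^ k = p at h1 h2
    refine lt_of_le_of_ne h1 fun h => ?_
    rw [← h, coeff_natDegree, leadingCoeff_eq_zero] at h2
    rw [h2, natDegree_zero] at h
    omega
  · have h1 : χ.eval (q * x i) = (-1) ^ (k + 1) * ∏ r, (x r - q * x i) := by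
      rw [hχ, Lagrange.eval_nodal]
      calc ∏ r, (q * x i - x r) = ∏ r, (-1) * (x r - q * x i) :=
            Finset.prod_congr rfl fun r _ => by ring
        _ = _ := by rw [Finset.prod_mul_distrib]; simp
    have h2 : χq.eval (x i) = ∏ r, (x i - q * x r) := Lagrange.eval_nodal
    have h3 : (∏ r, (x r - q * x i)) ≠ 0 :=
      Finset.prod_ne_zero_iff.2 fun j _ => sub_ne_zero.2 (hxq j i)
    have h4 : ((-1 : F) ^ k) * (-1) ^ k = 1 := by rw [← mul_pow]; simp
    simp only [eval_sub, eval_add, eval_mul, eval_C, eval_comp, eval_X, eval_pow, ha_eval, hb_eval,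
      h1, h2]
    generalize (∏ r, (x r - q * x i)) = d at h3 ⊢
    have h5 : ((-1 : F) ^ (k + 1) * d) ⁻¹ = -(-1) ^ k * d⁻¹ := by
      refine inv_eq_of_mul_eq_one_right ?_
      rw [pow_succ]
      calc (-1 : F) ^ k * -1 * d * (-(-1) ^ k * d⁻¹) = (-1) ^ k * (-1) ^ k * (d * d⁻¹) := by ring
        _ = 1 := by rw [h4, mul_inv_cancel₀ h3, one_mul]
    rw [div_eq_mul_inv _ ((-1 : F) ^ (k + 1) * d), h5]
    field_simp
    ring

variable {F : Type*} [Field F] {k : ℕ}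

/-- The determinant with first column `φ` and further columns `x_i^{k-1}, …, x_i^0`. -/
noncomputable def colDet (x φ : Fin (k + 1) → F) : F :=
  (Matrix.of fun i => (Fin.cons (φ i) (fun s : Fin k => x i ^ (k - 1 - (s : ℕ))) :
    Fin (k + 1) → F)).det

lemma colDet_linear (x : Fin (k + 1) → F) :
    ∃ c : Fin (k + 1) → F, ∀ φ, colDet x φ = ∑ i, φ i * c i := by
  refine ⟨fun i => (-1) ^ (i : ℕ) *
    (Matrix.of fun a (s : Fin k) => x (i.succAbove a) ^ (k - 1 - (s : ℕ))).det, fun φ => ?_⟩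
  rw [colDet, Matrix.det_succ_column_zero]
  refine Finset.sum_congr rfl fun i _ => ?_
  simp only [Matrix.of_apply, Fin.cons_zero]
  rw [mul_comm _ (φ i), mul_assoc]
  congr 3

/-- The first column is a combination of the others, with the coefficients of `p`. -/
lemma colDet_eval_eq_zero (x : Fin (k + 1) → F) (p : Polynomial F) (hp : p.natDegree < k) :
    colDet x (fun i => p.eval (x i)) = 0 := by
  rw [colDet, ← Matrix.exists_mulVec_eq_zero_iff]
  refine ⟨Fin.cons (-1) (fun s : Fin k => p.coeff (k - 1 - (s : ℕ))), ?_, ?_⟩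
  · intro h
    simpa using congrFun h 0
  · ext i
    rw [Matrix.mulVec, dotProduct, Fin.sum_univ_succ]
    simp only [Matrix.of_apply, Fin.cons_zero, Fin.cons_succ, Pi.zero_apply]
    rw [Polynomial.eval_eq_sum_range' hp, ← Finset.sum_range_reflect,
      ← Fin.sum_univ_eq_sum_range (fun s => p.coeff (k - 1 - s) * x i ^ (k - 1 - s)) k]
    simp [mul_comm]

lemma colDet_eq_sum (x φ : Fin (k + 1) → F) :
    colDet x φ = ∑ σ : Equiv.Perm (Fin (k + 1)), ((Equiv.Perm.sign σ : ℤ) : F) *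
      (φ (σ 0) * ∏ s : Fin k, x (σ s.succ) ^ (k - 1 - (s : ℕ))) := by
  rw [colDet, Matrix.det_apply']
  refine Finset.sum_congr rfl fun σ _ => ?_
  rw [Fin.prod_univ_succ]
  simp

/-- Moving the special column from first to last place is a cyclic rotation of `k + 1` indices, of
sign `(-1)^k`. -/
lemma colDet_eq_sum_last (x φ : Fin (k + 1) → F) :
    (-1) ^ k * colDet x φ = ∑ σ : Equiv.Perm (Fin (k + 1)), ((Equiv.Perm.sign σ : ℤ) : F) *
      ((∏ s : Fin k, x (σ s.castSucc) ^ (k - 1 - (s : ℕ))) * φ (σ (Fin.last k))) := by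
  rw [colDet_eq_sum, Finset.mul_sum]
  have h4 : ((-1 : F) ^ k) * (-1) ^ k = 1 := by rw [← mul_pow]; simp
  refine Fintype.sum_equiv (Equiv.mulRight (finRotate (k + 1))) _ _ fun σ => ?_
  simp only [Equiv.coe_mulRight, Equiv.Perm.sign_mul, sign_finRotate, Equiv.Perm.mul_apply,
    finRotate_apply, Fin.last_add_one, Fin.coeSucc_eq_succ]
  push_cast
  ring

/-- The product `∏_{r < s} (x_s - q x_r) ∏_s x_s^{n-1-s}`. -/
noncomputable def stairVand {A : Type*} [CommRing A] (q : A) {n : ℕ} (x : Fin n → A) : A :=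
  qVand q x * ∏ s : Fin n, x s ^ (n - 1 - (s : ℕ))

/-- The polynomial expressing the recursion for the constant terms. -/
noncomputable def recPoly {A : Type*} [CommRing A] (q : A) {k : ℕ} (x : Fin (k + 1) → A) : A :=
  stairVand q (fun s : Fin k => x s.castSucc) * x (Fin.last k) ^ (2 * k) -
    q ^ (k + 1) * (x 0 ^ (2 * k) * stairVand q (fun s : Fin k => x s.succ)) -
    (-1) ^ k * (1 - q) * stairVand q x

lemma map_stairVand {A B : Type*} [CommRing A] [CommRing B] (φ : A →+* B) (q : A) {n : ℕ}
    (x : Fin n → A) : φ (stairVand q x) = stairVand (φ q) (fun i => φ (x i)) := by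
  simp [stairVand, map_qVand, map_prod]

lemma map_recPoly {A B : Type*} [CommRing A] [CommRing B] (φ : A →+* B) (q : A) {k : ℕ}
    (x : Fin (k + 1) → A) : φ (recPoly q x) = recPoly (φ q) (fun i => φ (x i)) := by
  simp [recPoly, map_stairVand]

lemma qVand_succ {A : Type*} [CommRing A] (q : A) {k : ℕ} (x : Fin (k + 1) → A) :
    qVand q x = qVand q (fun s : Fin k => x s.succ) * ∏ s : Fin k, (x s.succ - q * x 0) := by
  simp only [qVand, Finset.prod_filter, Fintype.prod_prod_type, Fin.prod_univ_succ,
    Fin.succ_lt_succ_iff, Fin.succ_pos, Fin.not_lt_zero, if_false, if_true, one_mul]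
  rw [mul_comm]

lemma qVand_castSucc {A : Type*} [CommRing A] (q : A) {k : ℕ} (x : Fin (k + 1) → A) :
    qVand q x = qVand q (fun s : Fin k => x s.castSucc) *
      ∏ s : Fin k, (x (Fin.last k) - q * x s.castSucc) := by
  simp only [qVand, Finset.prod_filter, Fintype.prod_prod_type, Fin.prod_univ_castSucc,
    Fin.castSucc_lt_castSucc_iff, Fin.castSucc_lt_last, lt_irrefl, if_false, if_true, mul_one,
    Finset.prod_mul_distrib, (Fin.le_last _).not_gt, Finset.prod_const_one]

/-- Dividing leaves one variable's factors of `qVand` in the denominator. Completing that product by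
its diagonal factor `(1 - q) x` makes it run over all indices, hence invariant under permutations of
the others; this explains the exponent `2k + 1` and the prefactor `1 - q`. -/
lemma recPoly_div_qVand {q : F} (hq1 : q ≠ 1) {x : Fin (k + 1) → F} (hx0 : ∀ i, x i ≠ 0)
    (hxq : ∀ i j, x i ≠ q * x j) :
    recPoly q x / qVand q x =
      (1 - q) * ((∏ s : Fin k, x s.castSucc ^ (k - 1 - (s : ℕ))) *
        (x (Fin.last k) ^ (2 * k + 1) / ∏ r, (x (Fin.last k) - q * x r)) -
      q ^ (k + 1) * ((x 0 ^ (2 * k + 1) / ∏ r, (x r - q * x 0)) *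
        ∏ s : Fin k, x s.succ ^ (k - 1 - (s : ℕ))) -
      (-1) ^ k * (x 0 ^ k * ∏ s : Fin k, x s.succ ^ (k - 1 - (s : ℕ)))) := by
  have hne : ∀ i j, x i - q * x j ≠ 0 := fun i j => sub_ne_zero.2 (hxq i j)
  have hV : qVand q x ≠ 0 := Finset.prod_ne_zero_iff.2 fun p _ => hne _ _
  have hq1' : 1 - q ≠ 0 := sub_ne_zero.2 hq1.symm
  have h1 : stairVand q (fun s : Fin k => x s.castSucc) * x (Fin.last k) ^ (2 * k) / qVand q x =
      (1 - q) * ((∏ s : Fin k, x s.castSucc ^ (k - 1 - (s : ℕ))) *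
        (x (Fin.last k) ^ (2 * k + 1) / ∏ r, (x (Fin.last k) - q * x r))) := by
    rw [qVand_castSucc] at hV ⊢
    rw [stairVand, Fin.prod_univ_castSucc]
    have := left_ne_zero_of_mul hV
    have := right_ne_zero_of_mul hV
    have := hx0 (Fin.last k)
    rw [show x (Fin.last k) - q * x (Fin.last k) = (1 - q) * x (Fin.last k) by ring]
    field_simp
    ring
  have h2 : x 0 ^ (2 * k) * stairVand q (fun s : Fin k => x s.succ) / qVand q x =
      (1 - q) * ((x 0 ^ (2 * k + 1) / ∏ r, (x r - q * x 0)) *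
        ∏ s : Fin k, x s.succ ^ (k - 1 - (s : ℕ))) := by
    rw [qVand_succ] at hV ⊢
    rw [stairVand, Fin.prod_univ_succ (fun r => x r - q * x 0)]
    have := left_ne_zero_of_mul hV
    have := right_ne_zero_of_mul hV
    have := hx0 0
    rw [show x 0 - q * x 0 = (1 - q) * x 0 by ring]
    field_simp
    ring
  have h3 : stairVand q x / qVand q x = x 0 ^ k * ∏ s : Fin k, x s.succ ^ (k - 1 - (s : ℕ)) := by
    rw [stairVand, mul_div_cancel_left₀ _ hV, Fin.prod_univ_succ]
    simp [Nat.sub_sub, add_comm]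
  rw [recPoly, sub_div, sub_div, h1, mul_div_assoc, h2, mul_div_assoc, h3]
  ring

lemma sum_sign_recPoly_div_qVand (hk : 0 < k) {q : F} (hq : q ≠ 0) (hq1 : q ≠ 1)
    {x : Fin (k + 1) → F} (hx : Function.Injective x) (hx0 : ∀ i, x i ≠ 0)
    (hxq : ∀ i j, x i ≠ q * x j) :
    ∑ σ : Equiv.Perm (Fin (k + 1)), ((Equiv.Perm.sign σ : ℤ) : F) *
      (recPoly q (fun i => x (σ i)) / qVand q (fun i => x (σ i))) = 0 := by
  obtain ⟨p, hp, hpx⟩ := exists_interpolation hk hq hx hxq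
  obtain ⟨c, hc⟩ := colDet_linear x
  have hperm : ∀ σ : Equiv.Perm (Fin (k + 1)), ∀ g : Fin (k + 1) → F,
      ∏ r, g (σ r) = ∏ r, g r := fun σ g => Equiv.prod_comp σ g
  have h0 := colDet_eval_eq_zero x p hp
  have h1 := colDet_eq_sum_last x (fun i => x i ^ (2 * k + 1) / ∏ r, (x i - q * x r))
  have h2 := colDet_eq_sum x (fun i => x i ^ (2 * k + 1) / ∏ r, (x r - q * x i))
  have h3 := colDet_eq_sum x (fun i => x i ^ k)
  have h4 : ((-1 : F) ^ k) * (-1) ^ k = 1 := by rw [← mul_pow]; simp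
  have h5 : colDet x (fun i => p.eval (x i)) =
      colDet x (fun i => x i ^ (2 * k + 1) / ∏ r, (x i - q * x r)) -
      (-1) ^ k * q ^ (k + 1) * colDet x (fun i => x i ^ (2 * k + 1) / ∏ r, (x r - q * x i)) -
      colDet x (fun i => x i ^ k) := by
    simp only [hc, hpx, sub_mul, Finset.sum_sub_distrib, Finset.mul_sum, mul_assoc]
  have h6 : ∀ σ : Equiv.Perm (Fin (k + 1)), ((Equiv.Perm.sign σ : ℤ) : F) *
      (recPoly q (fun i => x (σ i)) / qVand q (fun i => x (σ i))) =
      (1 - q) * (((Equiv.Perm.sign σ : ℤ) : F) *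
        ((∏ s : Fin k, x (σ s.castSucc) ^ (k - 1 - (s : ℕ))) *
        (x (σ (Fin.last k)) ^ (2 * k + 1) / ∏ r, (x (σ (Fin.last k)) - q * x r)))) -
      (1 - q) * q ^ (k + 1) * (((Equiv.Perm.sign σ : ℤ) : F) *
        ((x (σ 0) ^ (2 * k + 1) / ∏ r, (x r - q * x (σ 0))) *
        ∏ s : Fin k, x (σ s.succ) ^ (k - 1 - (s : ℕ)))) -
      (1 - q) * (-1) ^ k * (((Equiv.Perm.sign σ : ℤ) : F) *
        (x (σ 0) ^ k * ∏ s : Fin k, x (σ s.succ) ^ (k - 1 - (s : ℕ)))) := by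
    intro σ
    rw [recPoly_div_qVand hq1 (fun i => hx0 (σ i)) (fun i j => hxq (σ i) (σ j)),
      hperm σ (fun r => x (σ (Fin.last k)) - q * x r), hperm σ (fun r => x r - q * x (σ 0))]
    ring
  simp only [h6, Finset.sum_sub_distrib, ← Finset.mul_sum, ← h1, ← h2, ← h3]
  rw [h0] at h5
  linear_combination -(1 - q) * (-1) ^ k * h5 + (1 - q) * q ^ (k + 1) *
    colDet x (fun i => x i ^ (2 * k + 1) / ∏ r, (x r - q * x i)) * h4

open MvPolynomial in
/-- A functional killed by the Hecke relations kills the recursion polynomial. -/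
theorem map_recPoly_eq_zero {𝕜 : Type*} [Field 𝕜] [CharZero 𝕜] (hk : 0 < k) {q : 𝕜} (hq0 : q ≠ 0)
    (hq : ∀ i : ℕ, 0 < i → q ^ i ≠ 1) {V : Type*} [AddCommGroup V] [Module 𝕜 V]
    (Φ : MvPolynomial (Fin (k + 1)) 𝕜 →ₗ[𝕜] V)
    (hΦ : ∀ (i : Fin k) h, rename (Equiv.swap i.castSucc i.succ) h = h →
      Φ ((X i.succ - C q * X i.castSucc) * h) = 0) :
    Φ (recPoly (C q) X) = 0 := by
  have hq1 : q ≠ 1 := by simpa using hq 1 one_pos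
  set ψ := algebraMap (MvPolynomial (Fin (k + 1)) 𝕜) (FracPoly 𝕜 (Fin (k + 1))) with hψ
  have hψi : Function.Injective ψ := FaithfulSMul.algebraMap_injective _ _
  have hXq : ∀ i j, (X i : MvPolynomial (Fin (k + 1)) 𝕜) ≠ C q * X j := by
    intro i j h
    have h1 := congrArg (MvPolynomial.eval fun _ => (1 : 𝕜)) h
    simp only [eval_X, map_mul, eval_C, mul_one] at h1
    exact hq1 h1.symm
  have hD : qDisc (C q) (X : Fin (k + 1) → MvPolynomial (Fin (k + 1)) 𝕜) ≠ 0 :=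
    Finset.prod_ne_zero_iff.2 fun p _ => sub_ne_zero.2 (hXq _ _)
  refine map_eq_zero_of_antisymm_eq_zero (q := q) (fun i h => ?_) Φ hΦ hD (hψi ?_)
  · have := geom_sum_mul q (i + 2)
    rw [h, zero_mul] at this
    exact hq (i + 2) (by omega) (sub_eq_zero.1 this.symm)
  · have hxq : ∀ i j, genPt 𝕜 i ≠ ψ (C q) * genPt 𝕜 j := fun i j h => by
      rw [genPt, genPt, ← map_mul] at h
      exact hXq i j (hψi h)
    -- Since `qVandRev = qDisc / qVand` and `qDisc` is symmetric, it factors out of the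
    -- antisymmetrization.
    have h1 : ∀ σ : Equiv.Perm (Fin (k + 1)),
        ψ (((Equiv.Perm.sign σ : ℤ) : 𝕜) • rename σ (qVandRev (C q) X * recPoly (C q) X)) =
        ψ (qDisc (C q) X) * (((Equiv.Perm.sign σ : ℤ) : FracPoly 𝕜 (Fin (k + 1))) *
          (recPoly (ψ (C q)) (fun i => genPt 𝕜 (σ i)) /
            qVand (ψ (C q)) (fun i => genPt 𝕜 (σ i)))) := by
      intro σ
      have hV : qVand (ψ (C q)) (fun i => genPt 𝕜 (σ i)) ≠ 0 :=
        Finset.prod_ne_zero_iff.2 fun p _ => sub_ne_zero.2 (hxq _ _)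
      set θ : MvPolynomial (Fin (k + 1)) 𝕜 →+* FracPoly 𝕜 (Fin (k + 1)) :=
        ψ.comp (rename σ : MvPolynomial (Fin (k + 1)) 𝕜 →ₐ[𝕜] _).toRingHom with hθ
      have hθC : θ (C q) = ψ (C q) := by simp [hθ]
      have hθX : ∀ i, θ (X i) = genPt 𝕜 (σ i) := by simp [hθ, genPt, hψ]
      have h2 : ψ (rename σ (qVandRev (C q) X * recPoly (C q) X)) =
          qVandRev (ψ (C q)) (fun i => genPt 𝕜 (σ i)) *
            recPoly (ψ (C q)) (fun i => genPt 𝕜 (σ i)) := by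
        change θ _ = _
        rw [map_mul, map_qVandRev, map_recPoly, hθC]
        simp only [hθX]
      have h3 : ψ (qDisc (C q) X) = qVand (ψ (C q)) (fun i => genPt 𝕜 (σ i)) *
          qVandRev (ψ (C q)) (fun i => genPt 𝕜 (σ i)) := by
        rw [qVand_mul_qVandRev, qDisc_comp_perm, map_qDisc]
        rfl
      rw [Int.cast_smul_eq_zsmul 𝕜, map_zsmul, h2, h3, zsmul_eq_mul]
      field_simp
    rw [map_sum, map_zero, Finset.sum_congr rfl fun σ _ => h1 σ, ← Finset.mul_sum,
      sum_sign_recPoly_div_qVand hk, mul_zero]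
    · exact fun h => hq0 (C_injective _ _ (hψi (by rw [h, map_zero, map_zero])))
    · exact fun h => hq1 (C_injective _ _ (hψi (by rw [h, map_one, map_one])))
    · exact genPt_injective
    · exact fun i h => X_ne_zero i (hψi (by rw [map_zero]; exact h))
    · exact hxq

end Antisymmetrization

/-! ### The functional `u^β ↦ ∏ M_{1, β_i + n₀}` -/

section Functional

open MvPolynomial

lemma M1_relation (a b : ℤ) :
    M1 a * M1 (b + 1) - frakq • (M1 (a + 1) * M1 b) + M1 b * M1 (a + 1) -
      frakq • (M1 (b + 1) * M1 a) = 0 := by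
  have h := RingQuot.mkAlgHom_rel GroundField (EERel.quadratic (-a - 1) (-b - 1))
  have he : ∀ r, RingQuot.mkAlgHom GroundField EERel (FreeAlgebra.ι GroundField r) = e r :=
    fun _ => rfl
  simp only [map_sub, map_mul, map_smul, he] at h
  simp only [sub_add_cancel] at h
  change e (-a) * e (-b - 1) - frakq • (e (-a - 1) * e (-b)) =
    frakq • (e (-b - 1) * e (-a)) - e (-b) * e (-a - 1) at h
  simp only [M1, neg_add, ← sub_eq_add_neg]
  rw [h]
  abel

/-- Isolates two adjacent factors of an ordered product, so that a quadratic relation can be applied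
between fixed outer factors. -/
lemma exists_ofFn_prod_eq {R : Type*} [Monoid R] {k : ℕ} (i : Fin k) (g : Fin (k + 1) → R) :
    ∃ l r : R, ∀ g' : Fin (k + 1) → R, (∀ j, j ≠ i.castSucc → j ≠ i.succ → g' j = g j) →
      (List.ofFn g').prod = l * (g' i.castSucc * g' i.succ) * r := by
  induction k with
  | zero => exact i.elim0
  | succ k ih =>
    refine Fin.cases ?_ (fun i => ?_) i
    · refine ⟨1, (List.ofFn fun j : Fin k => g j.succ.succ).prod, fun g' hg' => ?_⟩
      have : (fun j : Fin k => g' j.succ.succ) = fun j => g j.succ.succ := by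
        funext j
        apply hg' <;> simp [Fin.ext_iff]
      rw [List.ofFn_succ, List.ofFn_succ, List.prod_cons, List.prod_cons, this]
      simp [mul_assoc]
    · obtain ⟨l, r, h⟩ := ih i (fun j => g j.succ)
      refine ⟨g 0 * l, r, fun g' hg' => ?_⟩
      rw [List.ofFn_succ, List.prod_cons, h (fun j => g' j.succ), hg' 0]
      · simp only [Fin.succ_castSucc, mul_assoc]
      · simp [Fin.ext_iff]
      · simp [Fin.ext_iff]
      · intro j h1 h2
        apply hg'
        · rw [← Fin.succ_castSucc]; exact fun h => h1 (Fin.succ_injective _ h)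
        · exact fun h => h2 (Fin.succ_injective _ h)

/-- The linear map sending the monomial `x^β` to the ordered product `∏ M_{1, β_i + n₀}`. -/
noncomputable def evalM (n₀ : ℤ) (k : ℕ) : MvPolynomial (Fin k) GroundField →ₗ[GroundField] UPos :=
  (basisMonomials (Fin k) GroundField).constr GroundField
    fun β => (List.ofFn fun i => M1 ((β i : ℤ) + n₀)).prod

lemma evalM_monomial (n₀ : ℤ) {k : ℕ} (β : Fin k →₀ ℕ) :
    evalM n₀ k (monomial β 1) = (List.ofFn fun i => M1 ((β i : ℤ) + n₀)).prod := by
  have := (basisMonomials (Fin k) GroundField).constr_basis GroundField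
    (fun β => (List.ofFn fun i => M1 ((β i : ℤ) + n₀)).prod) β
  rwa [coe_basisMonomials] at this

lemma linearMap_eq_of_monomial {σ V : Type*} [AddCommGroup V] [Module GroundField V]
    {L₁ L₂ : MvPolynomial σ GroundField →ₗ[GroundField] V}
    (h : ∀ β, L₁ (monomial β 1) = L₂ (monomial β 1)) : L₁ = L₂ := by
  refine (basisMonomials σ GroundField).ext fun β => ?_
  simpa using h β

/-- A symmetric `h` is half of `h + s h`, so it is enough to treat `f + s f` for a monomial `f`.
There the claim is `M1_relation` multiplied on both sides by the unaffected generators. -/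
lemma evalM_relation (n₀ : ℤ) {k : ℕ} (i : Fin k) (h : MvPolynomial (Fin (k + 1)) GroundField)
    (hs : rename (Equiv.swap i.castSucc i.succ) h = h) :
    evalM n₀ (k + 1) ((X i.succ - C frakq * X i.castSucc) * h) = 0 := by
  obtain ⟨s, hs_def⟩ : ∃ s, s = Equiv.swap i.castSucc i.succ := ⟨_, rfl⟩
  rw [← hs_def] at hs
  have hsl : s i.castSucc = i.succ := by rw [hs_def, Equiv.swap_apply_left]
  have hsr : s i.succ = i.castSucc := by rw [hs_def, Equiv.swap_apply_right]
  have hso : ∀ j, j ≠ i.castSucc → j ≠ i.succ → s j = j := fun j h1 h2 => by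
    rw [hs_def, Equiv.swap_apply_of_ne_of_ne h1 h2]
  have hne : i.castSucc ≠ i.succ := Fin.castSucc_lt_succ.ne
  let L : MvPolynomial (Fin (k + 1)) GroundField →ₗ[GroundField] UPos :=
    evalM n₀ (k + 1) ∘ₗ LinearMap.mulLeft GroundField (X i.succ - C frakq * X i.castSucc) ∘ₗ
      (LinearMap.id + (rename s : MvPolynomial (Fin (k + 1)) GroundField →ₐ[GroundField] _).toLinearMap)
  have hL : L = 0 := by
    refine linearMap_eq_of_monomial fun β => ?_
    obtain ⟨l, r, hlr⟩ := exists_ofFn_prod_eq i (fun j => M1 ((β j : ℤ) + n₀))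
    have hmon : ∀ γ : Fin (k + 1) →₀ ℕ, (∀ j, j ≠ i.castSucc → j ≠ i.succ → γ j = β j) →
        evalM n₀ (k + 1) (monomial γ 1) =
          l * (M1 ((γ i.castSucc : ℤ) + n₀) * M1 ((γ i.succ : ℤ) + n₀)) * r := by
      intro γ hγ
      rw [evalM_monomial]
      exact hlr (fun j => M1 ((γ j : ℤ) + n₀)) fun j h1 h2 => by simp only [hγ j h1 h2]
    have hsβ : ∀ j, (Finsupp.mapDomain s β) j = β (s j) := fun j => by
      have hss : s (s j) = j := by rw [hs_def, Equiv.swap_apply_self]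
      conv_lhs => rw [← hss]
      exact Finsupp.mapDomain_apply s.injective _ _
    have hX : ∀ (j : Fin (k + 1)) (γ : Fin (k + 1) →₀ ℕ),
        (X j * monomial γ 1 : MvPolynomial (Fin (k + 1)) GroundField) =
          monomial (Finsupp.single j 1 + γ) 1 := fun j γ => by
      rw [X, monomial_mul, one_mul]
    have e1 := hmon (Finsupp.single i.succ 1 + β) (fun j h1 h2 => by
      simp [h2])
    have e2 := hmon (Finsupp.single i.castSucc 1 + β) (fun j h1 h2 => by
      simp [h1])
    have e3 := hmon (Finsupp.single i.succ 1 + Finsupp.mapDomain s β) (fun j h1 h2 => by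
      rw [Finsupp.add_apply, hsβ, hso j h1 h2]; simp [h2])
    have e4 := hmon (Finsupp.single i.castSucc 1 + Finsupp.mapDomain s β) (fun j h1 h2 => by
      rw [Finsupp.add_apply, hsβ, hso j h1 h2]; simp [h1])
    have hrel := M1_relation ((β i.castSucc : ℤ) + n₀) ((β i.succ : ℤ) + n₀)
    simp only [Finsupp.add_apply, Finsupp.single_apply, hne, hne.symm, if_true, if_false, hsβ,
      hsl, hsr, zero_add, Nat.cast_add, Nat.cast_one]
      at e1 e2 e3 e4
    have hmul : ∀ g : MvPolynomial (Fin (k + 1)) GroundField,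
        (X i.succ - C frakq * X i.castSucc) * g = X i.succ * g - frakq • (X i.castSucc * g) :=
      fun g => by rw [smul_eq_C_mul]; ring
    simp only [L, LinearMap.comp_apply, LinearMap.add_apply, LinearMap.id_apply,
      AlgHom.toLinearMap_apply, rename_monomial, LinearMap.mulLeft_apply, hmul,
      hX, map_add, map_sub, map_smul, LinearMap.zero_apply]
    rw [e1, e2, e3, e4]
    have h0 := congrArg (fun u => l * u * r) hrel
    simp only [mul_add, mul_sub, add_mul, sub_mul, mul_zero, zero_mul, mul_smul_comm,
      smul_mul_assoc] at h0
    rw [← h0]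
    simp only [add_comm (1 : ℤ), add_right_comm _ (1 : ℤ) n₀]
    abel
  have h1 := LinearMap.congr_fun hL h
  simp only [L, LinearMap.comp_apply, LinearMap.add_apply, LinearMap.id_apply,
    AlgHom.toLinearMap_apply, hs, LinearMap.mulLeft_apply, map_add,
    LinearMap.zero_apply] at h1
  rw [← two_smul GroundField] at h1
  exact (smul_eq_zero.1 h1).resolve_left two_ne_zero

lemma evalM_castSucc (n₀ : ℤ) {k : ℕ} (f : MvPolynomial (Fin k) GroundField) (p : ℕ) :
    evalM n₀ (k + 1) (rename Fin.castSucc f * X (Fin.last k) ^ p) =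
      evalM n₀ k f * M1 (p + n₀) := by
  have : evalM n₀ (k + 1) ∘ₗ LinearMap.mulRight GroundField (X (Fin.last k) ^ p) ∘ₗ
      (rename Fin.castSucc : MvPolynomial (Fin k) GroundField →ₐ[GroundField] _).toLinearMap =
      LinearMap.mulRight GroundField (M1 (p + n₀)) ∘ₗ evalM n₀ k := by
    refine linearMap_eq_of_monomial fun β => ?_
    simp only [LinearMap.comp_apply, AlgHom.toLinearMap_apply, rename_monomial,
      LinearMap.mulRight_apply, X_pow_eq_monomial, monomial_mul, one_mul, evalM_monomial]
    rw [List.ofFn_succ', List.concat_eq_append, List.prod_append, List.prod_singleton]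
    congr 2
    · congr 1
      funext i
      simp [Finsupp.mapDomain_apply (Fin.castSucc_injective k)]
    · rw [Finsupp.add_apply, Finsupp.mapDomain_of_notMem_range _ _ (by
        rintro ⟨i, hi⟩; exact (Fin.castSucc_lt_last i).ne hi)]
      simp
  exact LinearMap.congr_fun this f

lemma evalM_succ (n₀ : ℤ) {k : ℕ} (f : MvPolynomial (Fin k) GroundField) (p : ℕ) :
    evalM n₀ (k + 1) (X 0 ^ p * rename Fin.succ f) = M1 (p + n₀) * evalM n₀ k f := by
  have : evalM n₀ (k + 1) ∘ₗ LinearMap.mulLeft GroundField (X 0 ^ p) ∘ₗ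
      (rename Fin.succ : MvPolynomial (Fin k) GroundField →ₐ[GroundField] _).toLinearMap =
      LinearMap.mulLeft GroundField (M1 (p + n₀)) ∘ₗ evalM n₀ k := by
    refine linearMap_eq_of_monomial fun β => ?_
    simp only [LinearMap.comp_apply, AlgHom.toLinearMap_apply, rename_monomial,
      LinearMap.mulLeft_apply, X_pow_eq_monomial, monomial_mul, one_mul, evalM_monomial]
    rw [List.ofFn_succ, List.prod_cons]
    congr 2
    · rw [Finsupp.add_apply, Finsupp.mapDomain_of_notMem_range _ _ (by
        rintro ⟨i, hi⟩; exact Fin.succ_ne_zero i hi)]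
      simp
    · congr 1
      funext i
      simp [Finsupp.mapDomain_apply (Fin.succ_injective k)]
  exact LinearMap.congr_fun this f

lemma frakq_ne_zero : frakq ≠ 0 := pow_ne_zero _ RatFunc.X_ne_zero

lemma frakq_pow_ne_one (i : ℕ) (hi : 0 < i) : frakq ^ i ≠ 1 := by
  intro h
  have h1 : (algebraMap (Polynomial ℂ) (RatFunc ℂ)) (Polynomial.X ^ (2 * i)) =
      algebraMap (Polynomial ℂ) (RatFunc ℂ) 1 := by
    rw [map_pow, RatFunc.algebraMap_X, map_one, pow_mul]
    exact h
  have h2 := congrArg Polynomial.natDegree (RatFunc.algebraMap_injective ℂ h1)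
  rw [Polynomial.natDegree_X_pow, Polynomial.natDegree_one] at h2
  omega

/-- The coefficient of `(u_1 ⋯ u_k)^n` in `Δ(u) 𝔪_1(u_1) ⋯ 𝔪_1(u_k)`. -/
noncomputable def ctM (k : ℕ) (n : ℤ) : UPos := evalM (n - k + 1) k (stairVand (C frakq) X)

lemma ctM_one (n : ℤ) : ctM 1 n = M1 n := by
  have h : (stairVand (C frakq) X : MvPolynomial (Fin 1) GroundField) = monomial 0 1 := by
    rw [stairVand, qVand_succ]
    simp [qVand]
  rw [ctM, h, evalM_monomial]
  simp

/-- The three terms of `recPoly` evaluate to `ctM k (n - 1) * M1 (n + k)`, the reversed product, and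
`ctM (k + 1) n`. The common shift `n - k` turns the exponent `2k` into the index `n + k`. -/
lemma ctM_succ {k : ℕ} (hk : 0 < k) (n : ℤ) :
    ctM (k + 1) n = ((-1) ^ k / (1 - frakq)) •
      qComm (frakq ^ (k + 1)) (ctM k (n - 1)) (M1 (n + k)) := by
  have h := map_recPoly_eq_zero hk frakq_ne_zero frakq_pow_ne_one (evalM (n - k) (k + 1))
    (fun i h hs => evalM_relation _ i h hs)
  have hr1 : stairVand (C frakq) (fun s : Fin k => X s.castSucc) =
      (rename Fin.castSucc (stairVand (C frakq) X) :
        MvPolynomial (Fin (k + 1)) GroundField) := by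
    have := map_stairVand (rename Fin.castSucc :
      MvPolynomial (Fin k) GroundField →ₐ[GroundField]
        MvPolynomial (Fin (k + 1)) GroundField).toRingHom (C frakq) X
    simpa using this.symm
  have hr2 : stairVand (C frakq) (fun s : Fin k => X s.succ) =
      (rename Fin.succ (stairVand (C frakq) X) :
        MvPolynomial (Fin (k + 1)) GroundField) := by
    have := map_stairVand (rename Fin.succ :
      MvPolynomial (Fin k) GroundField →ₐ[GroundField]
        MvPolynomial (Fin (k + 1)) GroundField).toRingHom (C frakq) X
    simpa using this.symm
  have hc : (-1) ^ k * (1 - C frakq) =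
      (C ((-1) ^ k * (1 - frakq)) : MvPolynomial (Fin (k + 1)) GroundField) := by simp
  rw [recPoly, hr1, hr2, hc, ← C_pow, ← smul_eq_C_mul, ← smul_eq_C_mul, map_sub, map_sub, map_smul,
    map_smul, evalM_castSucc, evalM_succ] at h
  have e1 : ctM k (n - 1) = evalM (n - k) k (stairVand (C frakq) X) := by
    rw [ctM]; congr 2; ring
  have e2 : ctM (k + 1) n = evalM (n - k) (k + 1) (stairVand (C frakq) X) := by
    rw [ctM]; congr 2; push_cast; ring
  have e3 : ((2 * k : ℕ) : ℤ) + (n - k) = n + k := by push_cast; ring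
  rw [e3, ← e1, ← e2, sub_eq_zero] at h
  have hq : 1 - frakq ≠ 0 := sub_ne_zero.2 (by simpa using (frakq_pow_ne_one 1 one_pos).symm)
  have h4 : ((-1 : GroundField) ^ k) * (-1) ^ k = 1 := by rw [← mul_pow]; simp
  rw [qComm, h, smul_smul, div_mul_eq_mul_div, ← mul_assoc, h4, one_mul, div_self hq, one_smul]

lemma M_eq_ctM {k : ℕ} (hk : 1 ≤ k) (n : ℤ) : M k n = ctM k n := by
  induction k, hk using Nat.le_induction generalizing n with
  | base => rw [ctM_one]; simp [M, nestedComm]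
  | succ k hk ih =>
    rw [ctM_succ hk, ← ih]
    obtain ⟨j, rfl⟩ : ∃ j, k = j + 1 := ⟨k - 1, by omega⟩
    have hexp : (j + 1 + 1) * (j + 1 + 1 - 1) / 2 = (j + 1) * (j + 1 - 1) / 2 + (j + 1) := by
      simp only [Nat.add_sub_cancel]
      rw [show (j + 1 + 1) * (j + 1) = (j + 1) * j + (j + 1) * 2 by ring,
        Nat.add_mul_div_right _ _ two_pos]
    rw [M, M, hexp]
    simp only [Nat.add_sub_cancel, nestedComm]
    have e1 : n - 1 - ((j + 1 : ℕ) : ℤ) + 1 = n - ((j + 1 + 1 : ℕ) : ℤ) + 1 := by push_cast; ring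
    have e2 : n - ((j + 1 + 1 : ℕ) : ℤ) + 1 + 2 * ((j : ℤ) + 1) = n + ((j + 1 : ℕ) : ℤ) := by
      push_cast; ring
    rw [e1, e2]
    simp only [qComm, smul_mul_assoc, mul_smul_comm, smul_sub, smul_smul]
    generalize 1 - frakq = c
    congr 2 <;> ring

end Functional

/-! ### Comparison with the constant term -/

section ConstantTerm

/-- The coefficient at `c` of the product of a Laurent polynomial with the series `G`. -/
noncomputable def coeffMul {k : ℕ} (G : UZSeries k) (c : Expo k) :
    AddMonoidAlgebra GroundField (Expo k) →ₗ[GroundField] UPos :=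
  Finsupp.lsum GroundField (fun a => LinearMap.toSpanSingleton GroundField UPos (G (c - a))) ∘ₗ
    (AddMonoidAlgebra.coeffLinearEquiv GroundField).toLinearMap

lemma coeffMul_single {k : ℕ} (G : UZSeries k) (c a : Expo k) (r : GroundField) :
    coeffMul G c (AddMonoidAlgebra.single a r) = r • G (c - a) := by
  simp [coeffMul]

lemma seriesMul_ofLaurent {k : ℕ} (p : AddMonoidAlgebra GroundField (Expo k)) (G : UZSeries k)
    (c : Expo k) : seriesMul (ofLaurent p) G c = coeffMul G c p := by
  have h : Function.support (fun a => ofLaurent p a * G (c - a)) ⊆ (p.coeff.support : Set _) := by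
    intro a ha
    rw [Finset.mem_coe, Finsupp.mem_support_iff]
    intro h0
    exact ha (by simp [ofLaurent, h0])
  rw [seriesMul, finsum_eq_sum_of_support_subset _ h]
  simp [coeffMul, ofLaurent, Finsupp.sum, Algebra.smul_def]

lemma mulDefined_ofLaurent {k : ℕ} (p : AddMonoidAlgebra GroundField (Expo k)) (G : UZSeries k) :
    MulDefined (ofLaurent p) G := by
  refine fun c => p.coeff.support.finite_toSet.subset fun a ha => ?_
  rw [Finset.mem_coe, Finsupp.mem_support_iff]
  intro h0
  exact ha (by simp [ofLaurent, h0])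

lemma coeffMul_single_mul {k : ℕ} (G : UZSeries k) (c a : Expo k)
    (p : AddMonoidAlgebra GroundField (Expo k)) :
    coeffMul G c (AddMonoidAlgebra.single a 1 * p) = coeffMul G (c - a) p := by
  induction p using AddMonoidAlgebra.induction_linear with
  | zero => simp
  | add f g hf hg => rw [mul_add, map_add, map_add, hf, hg]
  | single b r =>
    rw [AddMonoidAlgebra.single_mul_single, coeffMul_single, coeffMul_single, one_mul, sub_sub]

/-- The embedding of polynomials into Laurent polynomials sending `x_i` to `u_i⁻¹`. -/
noncomputable def invLaurent (k : ℕ) :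
    MvPolynomial (Fin k) GroundField →ₐ[GroundField] AddMonoidAlgebra GroundField (Expo k) :=
  MvPolynomial.aeval fun i => AddMonoidAlgebra.single (-Pi.single i 1, 0) 1

lemma prod_single {k : ℕ} {ι : Type*} (s : Finset ι) (a : ι → Expo k) :
    ∏ i ∈ s, (AddMonoidAlgebra.single (a i) 1 : AddMonoidAlgebra GroundField (Expo k)) =
      AddMonoidAlgebra.single (∑ i ∈ s, a i) 1 := by
  classical
  induction s using Finset.induction_on with
  | empty => rfl
  | insert i s hi ih =>
    rw [Finset.prod_insert hi, Finset.sum_insert hi, ih, AddMonoidAlgebra.single_mul_single,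
      one_mul]

lemma prod_single_pow {k : ℕ} (n : Fin k → ℕ) :
    ∏ i, (AddMonoidAlgebra.single (-Pi.single i 1, 0) 1 :
      AddMonoidAlgebra GroundField (Expo k)) ^ n i =
      AddMonoidAlgebra.single (fun i => -(n i : ℤ), 0) 1 := by
  simp only [AddMonoidAlgebra.single_pow, one_pow, prod_single]
  congr 1
  ext j
  · simp [Prod.fst_sum, Finset.sum_apply, Pi.single_apply]
  · simp [Prod.snd_sum]

lemma invLaurent_monomial {k : ℕ} (β : Fin k →₀ ℕ) :
    invLaurent k (MvPolynomial.monomial β 1) =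
      AddMonoidAlgebra.single (fun i => -(β i : ℤ), 0) 1 := by
  rw [invLaurent, MvPolynomial.aeval_monomial, map_one, one_mul, Finsupp.prod_fintype _ _ (by simp),
    prod_single_pow]

lemma M_one (n : ℤ) : M 1 n = M1 n := by simp [M, nestedComm]

lemma coeffMul_invLaurent {k : ℕ} (n₀ : ℤ) (f : MvPolynomial (Fin k) GroundField) :
    coeffMul (orderedProd fun _ : Fin k => mSeries 1) (fun _ => n₀, 0) (invLaurent k f) =
      evalM n₀ k f := by
  have : coeffMul (orderedProd fun _ : Fin k => mSeries 1) (fun _ => n₀, 0) ∘ₗ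
      (invLaurent k).toLinearMap = evalM n₀ k := by
    refine linearMap_eq_of_monomial fun β => ?_
    rw [LinearMap.comp_apply, AlgHom.toLinearMap_apply, invLaurent_monomial, coeffMul_single,
      one_smul, evalM_monomial]
    simp [orderedProd, mSeries, M_one, add_comm]
  exact LinearMap.congr_fun this f

/-- Each factor `x_s - q x_r` is `x_s (1 - q u_s / u_r)`. With indices from zero, `x_s` occurs `s`
times in this way, and the staircase completes its exponent to `k - 1`. -/
lemma invLaurent_stairVand (k : ℕ) :
    invLaurent k (stairVand (MvPolynomial.C frakq) MvPolynomial.X) =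
      AddMonoidAlgebra.single (fun _ => -((k - 1 : ℕ) : ℤ), 0) 1 * Delta k := by
  set y : Fin k → AddMonoidAlgebra GroundField (Expo k) :=
    fun i => AddMonoidAlgebra.single (-Pi.single i 1, 0) 1 with hy
  have h0 : invLaurent k (stairVand (MvPolynomial.C frakq) MvPolynomial.X) =
      stairVand (algebraMap GroundField _ frakq) y := by
    have := map_stairVand (invLaurent k).toRingHom (MvPolynomial.C frakq) MvPolynomial.X
    simpa [invLaurent, hy] using this
  have h1 : ∀ p : Fin k × Fin k, y p.2 - algebraMap GroundField _ frakq * y p.1 =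
      y p.2 * (1 - ratioMonomial frakq p.2 p.1) := by
    intro p
    rw [mul_sub, mul_one, hy, ratioMonomial, AddMonoidAlgebra.single_mul_single,
      ← Algebra.smul_def, AddMonoidAlgebra.smul_single]
    congr 2
    · ext
      · simp only [Prod.mk_add_mk, Pi.add_apply, Pi.sub_apply, Pi.neg_apply]
        ring
      · simp
    · simp
  have h2 : ∏ p ∈ Finset.univ.filter (fun p : Fin k × Fin k => p.1 < p.2), y p.2 =
      ∏ s, y s ^ (s : ℕ) := by
    rw [Finset.prod_filter, Fintype.prod_prod_type_right]
    refine Finset.prod_congr rfl fun s _ => ?_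
    rw [← Finset.prod_filter]
    have hs : (Finset.univ.filter fun r : Fin k => r < s).card = s := by
      simpa [s.2.le] using Fin.card_filter_val_lt (n := k) (m := s)
    simp only [Finset.prod_const, hs]
  rw [h0, stairVand, qVand, Finset.prod_congr rfl fun p _ => h1 p, Finset.prod_mul_distrib, h2,
    mul_right_comm, ← Finset.prod_mul_distrib, ← prod_single_pow]
  congr 1
  refine Finset.prod_congr rfl fun s _ => ?_
  rw [← pow_add]
  congr 1
  omega

lemma seriesMul_Delta {k : ℕ} (hk : 1 ≤ k) (n : ℤ) :
    seriesMul (ofLaurent (Delta k)) (orderedProd fun _ : Fin k => mSeries 1) (fun _ => n, 0) =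
      ctM k n := by
  rw [ctM, ← coeffMul_invLaurent, invLaurent_stairVand, coeffMul_single_mul, seriesMul_ofLaurent]
  congr 2
  ext
  · simp only [Prod.mk_sub_mk, Pi.sub_apply]
    omega
  · simp

lemma seriesMul_Delta_eq_zero {k : ℕ} {c : Expo k} (hc : c.2 ≠ 0) :
    seriesMul (ofLaurent (Delta k)) (orderedProd fun _ : Fin k => mSeries 1) c = 0 := by
  have h : coeffMul (orderedProd fun _ : Fin k => mSeries 1)
      (c + (fun _ => -((k - 1 : ℕ) : ℤ), 0)) ∘ₗ (invLaurent k).toLinearMap = 0 := by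
    refine linearMap_eq_of_monomial fun β => ?_
    rw [LinearMap.comp_apply, AlgHom.toLinearMap_apply, invLaurent_monomial, coeffMul_single]
    simp [orderedProd, hc]
  have h1 := LinearMap.congr_fun h (stairVand (MvPolynomial.C frakq) MvPolynomial.X)
  rwa [LinearMap.comp_apply, AlgHom.toLinearMap_apply, invLaurent_stairVand, coeffMul_single_mul,
    add_sub_cancel_right, ← seriesMul_ofLaurent] at h1

lemma zsmul_prodOverZ (k : ℕ) (m : ℤ) : m • prodOverZ k = (fun _ => m, -m) := by
  ext <;> simp [prodOverZ]

lemma deltaAt_prodOverZ_ne_zero {k : ℕ} {c : Expo k} (h : deltaAt (prodOverZ k) c ≠ 0) :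
    c = (fun _ => -c.2, c.2) := by
  obtain ⟨m, hm⟩ : ∃ m : ℤ, (if c = m • prodOverZ k then (1 : UPos) else 0) ≠ 0 := by
    by_contra! h0
    exact h (finsum_eq_zero_of_forall_eq_zero h0)
  have hc : c = m • prodOverZ k := by
    by_contra hc
    exact hm (if_neg hc)
  rw [hc, zsmul_prodOverZ]
  simp

lemma deltaAt_prodOverZ (k : ℕ) (n : ℤ) : deltaAt (prodOverZ k) (fun _ => -n, n) = 1 := by
  rw [deltaAt, finsum_eq_single _ (-n)]
  · rw [if_pos]
    rw [zsmul_prodOverZ, neg_neg]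
  · intro m hm
    rw [if_neg]
    intro h
    have := congrArg Prod.snd h
    simp only [zsmul_prodOverZ] at this
    omega

/-- The first factor is free of `z` and the delta-function is supported on the exponents `(m, …, m,
-m)`, so `c` determines the only possible `a`. This gives both the finiteness and the collapse of
the final sum to one term. -/
lemma mul_deltaAt_ne_zero {k : ℕ} {c a : Expo k}
    (h : seriesMul (ofLaurent (Delta k)) (orderedProd fun _ : Fin k => mSeries 1) a *
      deltaAt (prodOverZ k) (c - a) ≠ 0) : a = (fun i => c.1 i + c.2, 0) := by
  have ha : a.2 = 0 := by
    by_contra ha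
    exact left_ne_zero_of_mul h (seriesMul_Delta_eq_zero ha)
  have h1 := deltaAt_prodOverZ_ne_zero (right_ne_zero_of_mul h)
  ext i
  · have := congrFun (congrArg Prod.fst h1) i
    simp only [Prod.fst_sub, Prod.snd_sub, Pi.sub_apply] at this
    dsimp only
    omega
  · exact ha

end ConstantTerm

end QSystem

open QSystem

theorem proposition6p3 (k : ℕ) (hk : 1 ≤ k) :
    MulDefined (ofLaurent (Delta k)) (orderedProd fun _ : Fin k => mSeries 1) ∧
    MulDefined
      (seriesMul (ofLaurent (Delta k)) (orderedProd fun _ : Fin k => mSeries 1))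
      (deltaAt (prodOverZ k)) ∧
    mSeries k =
      constTerm
        (seriesMul
          (seriesMul (ofLaurent (Delta k)) (orderedProd fun _ : Fin k => mSeries 1))
          (deltaAt (prodOverZ k))) := by
  refine ⟨mulDefined_ofLaurent _ _, fun c => (Set.finite_singleton _).subset fun a ha =>
    mul_deltaAt_ne_zero ha, ?_⟩
  funext n
  rw [mSeries, M_eq_ctM hk, constTerm, seriesMul, finsum_eq_single _ ((fun _ => n, 0) : Expo k)]
  · have h : ((0, n) : Expo k) - (fun _ => n, 0) = (fun _ => -n, n) := by ext <;> simp
    rw [h, deltaAt_prodOverZ, mul_one, seriesMul_Delta hk]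
  · intro a ha
    by_contra h
    exact ha ((mul_deltaAt_ne_zero h).trans (by ext <;> simp))
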